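/- Let $\mathbb{K}$ be an algebraically closed field of characteristic zero. For a finite simple graph $G$ with vertex set $V(G)$ and edge set $E(G)$, the toric ideal $I_G\subseteq \mathbb{K}[E(G)]$ is the kernel of the $\mathbb{K}$-algebra homomorphism $\mathbb{K}[E(G)]\to\mathbb{K}[V(G)]$ that sends each edge $e=\{a,b\}$ to $x_ax_b$. For a variable $y$ of a polynomial ring $R=\mathbb{K}[x_1,\ldots,x_n]$ and $0\neq f\in R$, let $\mathrm{in}_y(f)=y^dq$, where $d$ is the degree of $f$ in $y$ and $q$ (not involving $y$) is the coefficient of $y^d$ in $f$; for an ideal $I$ let $\mathrm{in}_y(I)$ be the ideal generated by all $\mathrm{in}_y(f)$, $f\in I$. A monomial order $<$ is $y$-compatible if $\mathrm{in}_<(f)=\mathrm{in}_<(\mathrm{in}_y(f))$ for all $f$. Given a Gröbner basis $\{g_1,\ldots,g_m\}$ of $I$ for a $y$-compatible order, with $\mathrm{in}_y(g_i)=y^{d_i}q_i$, put $C_{y,I}=\langle q_1,\ldots,q_m\rangle$ and $N_{y,I}=\langle q_i \mid d_i=0\rangle$. An ideal $I$ is unmixed if $\dim(R/I)=\dim(R/P)$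 for every $P\in\mathrm{Ass}_R(R/I)$. Recursively, an ideal $I$ of $R$ is geometrically vertex decomposable if it is unmixed and either (1) $I=\langle 1\rangle$ or $I$ is generated by a (possibly empty) subset of the variables of $R$, or (2) there are a variable $y$ of $R$ and a $y$-compatible monomial order with $\mathrm{in}_y(I)=C_{y,I}\cap(N_{y,I}+\langle y\rangle)$ such that the contractions of $C_{y,I}$ and $N_{y,I}$ to the polynomial ring in the variables other than $y$ are geometrically vertex decomposable. The ideals $\langle 0\rangle$ and $\langle 1\rangle$ of $\mathbb{K}$ (no variables) are geometrically vertex decomposable. Theorem. The toric ideal $I_G$ is geometrically vertex decomposable in $\mathbb{K}[E(G)]$ for each of the following graphs $G$ (up to isomorphism): 1. $G$ is a cycle (of any length $\geq 3$); 2. $G$ is the Ferrers graph $T_\lambda$ of a partition $\lambda=(\lambda_1\geq\cdots\geq\lambda_n)$ with $n\geq 1$ and $\lambda_n\geq 1$, i.e. the graph on the vertices $x_1,\ldots,x_n,y_1,\ldots,y_{\lambda_1}$ with edges $\{x_i,y_j\}$ for $1\leq i\leq n$, $1\leq j\leq\lambda_i$; 3. $G$ is the complete bipartite graph $K_{n,m}$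 with $n,m\geq 1$; 4. $G$ is the graph $G_{r,d}$ with $r\geq 3$ and $d\geq 2$, whose vertices are $x_1,x_2,y_1,\ldots,y_d,z_1,\ldots,z_{2r-3}$ and whose edges are all $\{x_i,y_j\}$ with $i\in\{1,2\}$, $1\leq j\leq d$, together with the edges $\{x_1,z_1\},\{z_1,z_2\},\ldots,\{z_{2r-4},z_{2r-3}\},\{z_{2r-3},x_2\}$ of a path of length $2r-2$ joining $x_1$ and $x_2$. -/

import Mathlib

universe u v

open MvPolynomial

noncomputable section

section GeometricVertexDecomposition

variable {σ : Type u} {K : Type v} [Field K]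

/-- The coefficient (a polynomial in the variables other than `y`) of the highest power of the
variable `y` that occurs in `f`. -/
def initialCoeff (y : σ) (f : MvPolynomial σ K) : MvPolynomial σ K :=
  ∑ s ∈ f.support with s y = f.degreeOf y, monomial (s.erase y) (f.coeff s)

/-- The initial `y`-form `in_y(f) = y ^ d * q` of `f`, where `d` is the degree of `f` in `y`. -/
def initialForm (y : σ) (f : MvPolynomial σ K) : MvPolynomial σ K :=
  X y ^ f.degreeOf y * initialCoeff y f

/-- The ideal `in_y(I)` generated by the initial `y`-forms of the elements of `I`. -/
def initialFormIdeal (y : σ) (I : Ideal (MvPolynomial σ K)) : Ideal (MvPolynomial σ K) :=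
  Ideal.span (initialForm y '' (I : Set (MvPolynomial σ K)))

/-- The monomial order `m` is `y`-compatible (for polynomials over `K`):
`in_<(f) = in_<(in_y(f))` for all `f`. -/
def IsCompatibleOrder (K : Type v) [Field K] (m : MonomialOrder σ) (y : σ) : Prop :=
  ∀ f : MvPolynomial σ K, m.leadingTerm f = m.leadingTerm (initialForm y f)

/-- The finite set `B` is a Gröbner basis of the ideal `I` with respect to the order `m`. -/
def IsGroebnerBasis (m : MonomialOrder σ) (I : Ideal (MvPolynomial σ K))
    (B : Finset (MvPolynomial σ K)) : Prop :=
  (∀ g ∈ B, g ∈ I) ∧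
    Ideal.span (m.leadingTerm '' (B : Set (MvPolynomial σ K))) =
      Ideal.span (m.leadingTerm '' (I : Set (MvPolynomial σ K)))

/-- The ideal `C_{y,I} = ⟨q_1, …, q_m⟩` computed from the basis `B = {y ^ d_i * q_i + r_i}`. -/
def cIdeal (y : σ) (B : Finset (MvPolynomial σ K)) : Ideal (MvPolynomial σ K) :=
  Ideal.span (initialCoeff y '' {g | g ∈ B})

/-- The ideal `N_{y,I} = ⟨q_i | d_i = 0⟩` computed from the basis `B = {y ^ d_i * q_i + r_i}`. -/
def nIdeal (y : σ) (B : Finset (MvPolynomial σ K)) : Ideal (MvPolynomial σ K) :=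
  Ideal.span (initialCoeff y '' {g | g ∈ B ∧ g.degreeOf y = 0})

/-- The contraction of an ideal to the polynomial ring in the variables other than `y`. -/
def contractIdeal (y : σ) (I : Ideal (MvPolynomial σ K)) :
    Ideal (MvPolynomial {x : σ // x ≠ y} K) :=
  I.comap (rename (R := K) (Subtype.val : {x : σ // x ≠ y} → σ))

/-- `I` is unmixed: `dim R/P = dim R/I` for all associated primes `P` of `R/I`. -/
def IsUnmixed {R : Type*} [CommRing R] (I : Ideal R) : Prop :=
  ∀ P ∈ associatedPrimes R (R ⧸ I), ringKrullDim (R ⧸ P) = ringKrullDim (R ⧸ I)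

/-- Geometrically vertex decomposable ideals of polynomial rings, by recursion on the variables.
The ideals `⟨0⟩` and `⟨1⟩` of the polynomial ring in no variables are covered by the first two
cases. -/
inductive IsGVD {K : Type v} [Field K] : {σ : Type u} → Ideal (MvPolynomial σ K) → Prop
  | unit {σ : Type u} : IsGVD (⊤ : Ideal (MvPolynomial σ K))
  | variables {σ : Type u} (I : Ideal (MvPolynomial σ K)) (unmixed : IsUnmixed I)
      (s : Set σ) (hs : I = Ideal.span (X '' s)) : IsGVD I
  | decomposition {σ : Type u} (I : Ideal (MvPolynomial σ K)) (unmixed : IsUnmixed I)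
      (y : σ) (m : MonomialOrder.{u, u} σ) (compatible : IsCompatibleOrder K m y)
      (B : Finset (MvPolynomial σ K)) (basis : IsGroebnerBasis m I B)
      (decomp : initialFormIdeal y I = cIdeal y B ⊓ (nIdeal y B ⊔ Ideal.span {X y}))
      (gvd_c : IsGVD (contractIdeal y (cIdeal y B)))
      (gvd_n : IsGVD (contractIdeal y (nIdeal y B))) : IsGVD I

end GeometricVertexDecomposition

section Graphs

/-- The map `K[E(G)] → K[V(G)]` sending an edge `{a, b}` to `x_a * x_b`. -/
def edgeMap (K : Type v) [Field K] {V : Type u} (G : SimpleGraph V) :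
    MvPolynomial G.edgeSet K →ₐ[K] MvPolynomial V K :=
  aeval fun e => Sym2.lift ⟨fun a b => X a * X b, fun a b => mul_comm (X a) (X b)⟩ (e : Sym2 V)

/-- The toric ideal `I_G` of the graph `G`. -/
def toricIdeal (K : Type v) [Field K] {V : Type u} (G : SimpleGraph V) :
    Ideal (MvPolynomial G.edgeSet K) :=
  RingHom.ker (edgeMap K G)

/-- The Ferrers graph `T_λ` of the partition `λ = (lam 0, …, lam n)`: the vertices are
`x_i = inl i` for the rows and `y_j = inr j` for the columns, and `x_i` is joined to `y_j` when
the diagram of `λ` has a dot in row `i` and column `j`. -/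
def ferrersGraph {n : ℕ} (lam : Fin (n + 1) → ℕ) : SimpleGraph (Fin (n + 1) ⊕ Fin (lam 0)) :=
  SimpleGraph.fromRel fun
    | .inl i, .inr j => (j : ℕ) < lam i
    | _, _ => False

/-- The vertices `x_1, x_2`, `y_1, …, y_d`, `z_1, …, z_{2r-3}` of `G_{r,d}` (numbered from `0`). -/
inductive GVertex (r d : ℕ) : Type
  | x (i : Fin 2)
  | y (j : Fin d)
  | z (k : Fin (2 * r - 3))

/-- The graph `G_{r,d}` (used for `r ≥ 3` and `d ≥ 2`): the complete bipartite graph with parts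
`{x_1, x_2}` and `{y_1, …, y_d}`, and the path `x_1, z_1, z_2, …, z_{2r-3}, x_2`. -/
def graphGrd (r d : ℕ) : SimpleGraph (GVertex r d) :=
  SimpleGraph.fromRel fun
    | .x _, .y _ => True
    | .x i, .z k => (i = 0 ∧ (k : ℕ) = 0) ∨ (i = 1 ∧ (k : ℕ) + 1 = 2 * r - 3)
    | .z k, .z l => (k : ℕ) + 1 = l
    | _, _ => False

end Graphs

end

/-! The proof is an induction on the number of variables, each step splitting off a variable `y`
that occurs linearly. Such a split (`IsGVD.of_linear`) needs no explicit Gröbner basis. For a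
lexicographic order with `y` largest, any Gröbner basis yields for `C` the ideal of all leading
`y`-coefficients of `I`, and for `N` the extension of the contraction of `I`. So it suffices to find
an ideal `J`, free of `y`, that contains every leading `y`-coefficient and each of whose elements
`q` occurs in some `y * q + r` in `I`. Unmixedness is automatic for toric ideals, which are prime.

For the kernel of a monomial map these conditions become statements about pairs of monomials with
equal image (`IsGVD.of_toric`). They are checked by an exchange argument: if a variable has the
larger exponent in one monomial, then at each vertex of that edge another variable has the larger
exponent in the other monomial (`exists_lt_of_exponentMap_eq`).

Two inductions cover all graphs. Ferrers and complete bipartite graphs are diagrams of cells with a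
nesting property that survives deleting a well-chosen cell of the last row; there `J` is again a
toric ideal of such a diagram, plus some variables (`isGVD_of_isRowNested`). Even cycles and
`G_{r,d}` consist of a path of even length whose ends are also joined through vertices `q_i`; there
`J` is generated by variables and one squarefree monomial (`isGVD_of_pathLabel`). An odd cycle has
zero toric ideal. -/

/-- The coefficient of `y ^ d` in `f`, as a polynomial in which `y` does not occur. -/
noncomputable def variableCoeff {σ : Type u} {K : Type v} [Field K] (y : σ) (d : ℕ)
    (f : MvPolynomial σ K) : MvPolynomial σ K :=
  ∑ s ∈ f.support with s y = d, monomial (s.erase y) (f.coeff s)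

/-! ### Coefficients with respect to one variable, and extended ideals. -/

section VariableCoeff

variable {σ : Type u} {K : Type v} [Field K] (y : σ)

theorem initialCoeff_eq_variableCoeff (f : MvPolynomial σ K) :
    initialCoeff y f = variableCoeff y (f.degreeOf y) f := rfl

theorem coeff_variableCoeff [DecidableEq σ] (d : ℕ) (f : MvPolynomial σ K) (s : σ →₀ ℕ) :
    (variableCoeff y d f).coeff s =
      if s y = 0 then f.coeff (s + Finsupp.single y d) else 0 := by
  classical
  simp only [variableCoeff, coeff_sum, coeff_monomial]
  split_ifs with hs
  · rw [Finset.sum_eq_single (s + Finsupp.single y d)]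
    · rw [if_pos]
      ext x
      by_cases hx : x = y
      · subst hx; simp [hs]
      · simp [Finsupp.erase_ne hx]
    · intro t ht hne
      rw [if_neg]
      rintro rfl
      apply hne
      simp only [Finset.mem_filter] at ht
      rw [← ht.2, Finsupp.erase_add_single]
    · intro h
      simp only [Finset.mem_filter, mem_support_iff, not_and, Finsupp.add_apply,
        Finsupp.single_eq_same, hs, zero_add, not_true_eq_false, imp_false, not_not] at h
      simp [h]
  · refine Finset.sum_eq_zero fun t _ => if_neg ?_
    rintro rfl
    simp at hs

theorem coeff_X_pow_mul_variableCoeff [DecidableEq σ] (d : ℕ) (f : MvPolynomial σ K)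
    (s : σ →₀ ℕ) :
    (X y ^ d * variableCoeff y d f).coeff s = if s y = d then f.coeff s else 0 := by
  classical
  rw [X_pow_eq_monomial, coeff_monomial_mul', one_mul, coeff_variableCoeff]
  by_cases h : s y = d
  · have h1 : Finsupp.single y d ≤ s := by simp [h]
    rw [if_pos h1, if_pos h, if_pos (by simp [h]), tsub_add_cancel_of_le h1]
  · rw [if_neg h]
    split_ifs with h1 h2
    · exfalso
      simp only [Finsupp.single_le_iff] at h1
      simp at h2
      omega
    · rfl
    · rfl

theorem variableCoeff_add (d : ℕ) (f g : MvPolynomial σ K) :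
    variableCoeff y d (f + g) = variableCoeff y d f + variableCoeff y d g := by
  classical
  ext s
  simp only [coeff_add, coeff_variableCoeff]
  split_ifs <;> simp

theorem variableCoeff_zero (d : ℕ) : variableCoeff y d (0 : MvPolynomial σ K) = 0 := by
  simp [variableCoeff]

theorem variableCoeff_monomial_mul {d : ℕ} (a : σ →₀ ℕ) (c : K) (g : MvPolynomial σ K)
    (h : a y ≤ d) :
    variableCoeff y d (monomial a c * g) =
      monomial (a.erase y) c * variableCoeff y (d - a y) g := by
  classical
  ext s
  simp only [coeff_variableCoeff, coeff_monomial_mul']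
  have key : a ≤ s + Finsupp.single y d ↔ a.erase y ≤ s := by
    refine forall_congr' fun x => ?_
    by_cases hx : x = y
    · subst hx; simp; omega
    · simp [Finsupp.erase_ne hx, Ne.symm hx]
  by_cases hle : a.erase y ≤ s
  · rw [if_pos hle, if_pos (key.2 hle)]
    have h1 : (s - a.erase y) y = s y := by simp
    rw [h1]
    split_ifs with hs
    · congr 2
      ext x
      by_cases hx : x = y
      · subst hx; simp [hs]
      · simp [Finsupp.erase_ne hx, Ne.symm hx]
    · simp
  · rw [if_neg hle, if_neg (mt key.1 hle)]
    simp

theorem variableCoeff_monomial_mul_of_lt {d : ℕ} (a : σ →₀ ℕ) (c : K) (g : MvPolynomial σ K)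
    (h : d < a y) : variableCoeff y d (monomial a c * g) = 0 := by
  classical
  ext s
  simp only [coeff_variableCoeff, coeff_monomial_mul', coeff_zero]
  split_ifs with h1 h2
  · have := h2 y
    simp at this; omega
  · rfl
  · rfl

theorem variableCoeff_of_degreeOf_lt {d : ℕ} {f : MvPolynomial σ K} (h : f.degreeOf y < d) :
    variableCoeff y d f = 0 := by
  refine Finset.sum_eq_zero fun s hs => ?_
  simp only [Finset.mem_filter] at hs
  have := le_degreeOf_of_mem_support y hs.1
  omega

theorem variableCoeff_zero_of_degreeOf_eq_zero {f : MvPolynomial σ K} (h : f.degreeOf y = 0) :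
    variableCoeff y 0 f = f := by
  classical
  have := coeff_X_pow_mul_variableCoeff y 0 f
  ext s
  rw [← one_mul (variableCoeff y 0 f), ← pow_zero (X y), this]
  split_ifs with hs
  · rfl
  · by_contra hne
    have := le_degreeOf_of_mem_support y (mem_support_iff.2 (Ne.symm hne))
    omega

theorem initialCoeff_of_degreeOf_eq_zero {f : MvPolynomial σ K} (h : f.degreeOf y = 0) :
    initialCoeff y f = f := by
  rw [initialCoeff_eq_variableCoeff, h, variableCoeff_zero_of_degreeOf_eq_zero y h]

theorem initialForm_of_degreeOf_eq_zero {f : MvPolynomial σ K} (h : f.degreeOf y = 0) :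
    initialForm y f = f := by
  rw [initialForm, initialCoeff_of_degreeOf_eq_zero y h, h, pow_zero, one_mul]

theorem variableCoeff_X_mul (d : ℕ) (g : MvPolynomial σ K) :
    variableCoeff y (d + 1) (X y * g) = variableCoeff y d g := by
  rw [X, variableCoeff_monomial_mul y _ _ _ (by simp)]
  simp

theorem sum_X_pow_mul_variableCoeff (f : MvPolynomial σ K) :
    ∑ d ∈ Finset.range (f.degreeOf y + 1), X y ^ d * variableCoeff y d f = f := by
  classical
  ext s
  simp only [coeff_sum, coeff_X_pow_mul_variableCoeff, Finset.sum_ite_eq, Finset.mem_range]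
  split_ifs with hs
  · rfl
  · by_contra hne
    have := le_degreeOf_of_mem_support y (mem_support_iff.2 (Ne.symm hne))
    omega

theorem degreeOf_rename_subtypeVal (q : MvPolynomial {x : σ // x ≠ y} K) :
    (rename Subtype.val q).degreeOf y = 0 := by
  classical
  rw [← Nat.le_zero, degreeOf_eq_sup]
  refine Finset.sup_le fun s hs => ?_
  obtain ⟨t, rfl, -⟩ := coeff_rename_ne_zero _ _ _ (mem_support_iff.1 hs)
  rw [Finsupp.mapDomain_of_notMem_range]
  simp

theorem exists_rename_eq_of_degreeOf_eq_zero {f : MvPolynomial σ K} (h : f.degreeOf y = 0) :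
    ∃ q : MvPolynomial {x : σ // x ≠ y} K, rename Subtype.val q = f := by
  refine exists_rename_eq_of_vars_subset_range f _ Subtype.val_injective ?_
  intro x hx
  simp only [Subtype.range_coe_subtype, Set.mem_ofPred_eq]
  rintro rfl
  exact mem_vars_iff_degreeOf_ne_zero.1 hx h

/-- `killCompl` is a retraction of the inclusion of polynomial rings, so it brings an element of the
extended ideal back into `J`. -/
theorem contractIdeal_map (J : Ideal (MvPolynomial {x : σ // x ≠ y} K)) :
    contractIdeal y (J.map (rename (R := K) (Subtype.val : {x : σ // x ≠ y} → σ))) = J := by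
  refine le_antisymm (fun q hq => ?_) Ideal.le_comap_map
  have h1 := Ideal.mem_map_of_mem (killCompl (R := K) (Subtype.val_injective (p := (· ≠ y))))
    (Ideal.mem_comap.1 hq)
  rw [Ideal.map_mapₐ, killCompl_comp_rename] at h1
  simpa [killCompl_rename_app, Ideal.map_id] using h1

/-- An ideal generated by polynomials free of `y` is homogeneous for the grading by `y`-degree. -/
theorem variableCoeff_mem_map {J : Ideal (MvPolynomial {x : σ // x ≠ y} K)}
    {f : MvPolynomial σ K}
    (hf : f ∈ J.map (rename (R := K) (Subtype.val : {x : σ // x ≠ y} → σ))) (d : ℕ) :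
    variableCoeff y d f ∈ J.map (rename (R := K) (Subtype.val : {x : σ // x ≠ y} → σ)) := by
  rw [Ideal.map] at hf
  induction hf using Submodule.span_induction generalizing d with
  | mem x hx =>
    obtain ⟨q, hq, rfl⟩ := hx
    rcases Nat.eq_zero_or_pos d with rfl | hd
    · have := variableCoeff_zero_of_degreeOf_eq_zero y (degreeOf_rename_subtypeVal y q)
      rw [this]; exact Ideal.mem_map_of_mem _ hq
    · have := variableCoeff_of_degreeOf_lt y ((degreeOf_rename_subtypeVal y q).trans_lt hd)
      rw [this]; exact zero_mem _
  | zero => rw [variableCoeff_zero]; exact zero_mem _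
  | add a b _ _ ha hb => rw [variableCoeff_add]; exact add_mem (ha d) (hb d)
  | smul a x _ hx =>
    rw [smul_eq_mul]
    induction a using MvPolynomial.induction_on' with
    | monomial a c =>
      rcases le_or_gt (a y) d with h | h
      · rw [variableCoeff_monomial_mul y _ _ _ h]
        exact Ideal.mul_mem_left _ _ (hx _)
      · rw [variableCoeff_monomial_mul_of_lt y _ _ _ h]; exact zero_mem _
    | add p q hp hq => rw [add_mul, variableCoeff_add]; exact add_mem hp hq

/-- The `y`-coefficients of `X y * g` are those of `g` shifted by one, and they determine membership
in an extended ideal. -/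
theorem mem_map_of_X_mul_mem_map {J : Ideal (MvPolynomial {x : σ // x ≠ y} K)}
    {g : MvPolynomial σ K}
    (hg : X y * g ∈ J.map (rename (R := K) (Subtype.val : {x : σ // x ≠ y} → σ))) :
    g ∈ J.map (rename (R := K) (Subtype.val : {x : σ // x ≠ y} → σ)) := by
  rw [← sum_X_pow_mul_variableCoeff y g]
  refine sum_mem fun d _ => Ideal.mul_mem_left _ _ ?_
  rw [← variableCoeff_X_mul]
  exact variableCoeff_mem_map y hg _

theorem degreeOf_X_mul_add_le (q r : MvPolynomial {x : σ // x ≠ y} K) :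
    (X y * rename Subtype.val q + rename Subtype.val r : MvPolynomial σ K).degreeOf y ≤ 1 := by
  classical
  refine (degreeOf_add_le _ _ _).trans (max_le ?_ ?_)
  · refine (degreeOf_mul_le _ _ _).trans ?_
    rw [degreeOf_rename_subtypeVal, degreeOf_X]; simp
  · rw [degreeOf_rename_subtypeVal]; omega

theorem variableCoeff_one_X_mul_add (q r : MvPolynomial {x : σ // x ≠ y} K) :
    variableCoeff y 1 (X y * rename Subtype.val q + rename Subtype.val r : MvPolynomial σ K) =
      rename Subtype.val q := by
  rw [variableCoeff_add, variableCoeff_of_degreeOf_lt y (d := 1)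
    (f := rename Subtype.val r) (by rw [degreeOf_rename_subtypeVal]; omega), add_zero,
    ← zero_add 1, variableCoeff_X_mul,
    variableCoeff_zero_of_degreeOf_eq_zero y (degreeOf_rename_subtypeVal y q)]

theorem initialForm_X_mul_add {q : MvPolynomial {x : σ // x ≠ y} K} (hq : q ≠ 0)
    (r : MvPolynomial {x : σ // x ≠ y} K) :
    initialForm y (X y * rename Subtype.val q + rename Subtype.val r : MvPolynomial σ K) =
      X y * rename Subtype.val q := by
  have h1 : (X y * rename Subtype.val q + rename Subtype.val r : MvPolynomial σ K).degreeOf y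
      = 1 := by
    refine le_antisymm (degreeOf_X_mul_add_le y q r) (not_lt.1 fun h => hq ?_)
    have := variableCoeff_of_degreeOf_lt y h
    rw [variableCoeff_one_X_mul_add] at this
    exact (map_eq_zero_iff _ (rename_injective _ Subtype.val_injective)).1 this
  rw [initialForm, initialCoeff_eq_variableCoeff, h1, variableCoeff_one_X_mul_add, pow_one]

end VariableCoeff

/-! ### Monomial orders that compare the exponent of `y` before anything else. -/

section Orders

variable {σ : Type u} {K : Type v} [Field K] {y : σ}

theorem exists_monomialOrder_apply_lt [Finite σ] (y : σ) :
    ∃ m : MonomialOrder.{u, u} σ, ∀ a b : σ →₀ ℕ, a y < b y → m.toSyn a < m.toSyn b := by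
  classical
  obtain ⟨n, ⟨e⟩⟩ := Finite.exists_equiv_fin σ
  -- The lexicographic order looks at the least index first, so `y` is made the least element of
  -- `σ`.
  let f : σ → ℕ := fun x => if x = y then 0 else e x + 1
  have hf : Function.Injective f := by
    intro a b h
    simp only [f] at h
    split_ifs at h with h1 h2 h2
    · rw [h1, h2]
    · exact e.injective (Fin.ext (by omega))
  let _ : LinearOrder σ := LinearOrder.lift' f hf
  refine ⟨MonomialOrder.lex, fun a b h => ?_⟩
  rw [MonomialOrder.lex_lt_iff]
  refine ⟨y, fun j hj => ?_, h⟩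
  have : f j < f y := hj
  simp [f] at this

/-- This makes the `y`-degree visible in leading exponents, so that it can be followed through a
division. -/
theorem degreeOf_eq_degree_apply {m : MonomialOrder σ}
    (hm : ∀ a b : σ →₀ ℕ, a y < b y → m.toSyn a < m.toSyn b) (f : MvPolynomial σ K) : f.degreeOf y = m.degree f y := by
  classical
  by_cases hf : f = 0
  · simp [hf]
  refine le_antisymm ?_ (le_degreeOf_of_mem_support y (m.degree_mem_support hf))
  rw [degreeOf_eq_sup]
  refine Finset.sup_le fun s hs => not_lt.1 fun h => ?_
  exact (hm _ _ h).not_ge (m.le_degree hs)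

theorem isCompatibleOrder_of_apply_lt {m : MonomialOrder σ}
    (hm : ∀ a b : σ →₀ ℕ, a y < b y → m.toSyn a < m.toSyn b) : IsCompatibleOrder K m y := by
  classical
  intro f
  by_cases hf : f = 0
  · simp [hf, initialForm, initialCoeff]
  have hc : ∀ s, (initialForm y f).coeff s = if s y = f.degreeOf y then f.coeff s else 0 :=
    coeff_X_pow_mul_variableCoeff y _ f
  have h1 : (initialForm y f).coeff (m.degree f) = f.coeff (m.degree f) := by
    rw [hc, if_pos (degreeOf_eq_degree_apply hm f).symm]
  have h2 : m.degree (initialForm y f) = m.degree f := by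
    apply m.toSyn.injective
    refine le_antisymm (m.degree_le_degree_of_support_subset fun s hs => ?_) (m.le_degree ?_)
    · rw [mem_support_iff, hc] at hs
      rw [mem_support_iff]
      split_ifs at hs <;> simp_all
    · rw [mem_support_iff, h1]
      exact m.coeff_degree_ne_zero_iff.2 hf
  rw [MonomialOrder.leadingTerm, MonomialOrder.leadingTerm, MonomialOrder.leadingCoeff,
    MonomialOrder.leadingCoeff, h2, h1]

end Orders


/-! ### The ideals `C` and `N` do not depend on the Gröbner basis. -/

section GroebnerBases

variable {σ : Type u} {K : Type v} [Field K] {y : σ}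

theorem exists_isGroebnerBasis [Finite σ] (m : MonomialOrder σ) (I : Ideal (MvPolynomial σ K)) :
    ∃ B, IsGroebnerBasis m I B := by
  classical
  obtain ⟨S, hS, hspan⟩ := (Submodule.fg_span_iff_fg_span_finset_subset
    (m.leadingTerm '' (I : Set (MvPolynomial σ K)))).1 (IsNoetherian.noetherian (R := MvPolynomial σ K) _)
  obtain ⟨B, hB, rfl⟩ := Finset.subset_set_image_iff.1 hS
  refine ⟨B, fun g hg => hB hg, ?_⟩
  rw [Finset.coe_image] at hspan
  exact hspan.symm

/-- One step of the division algorithm by a Gröbner basis. -/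
theorem IsGroebnerBasis.exists_reduction {m : MonomialOrder σ} {I : Ideal (MvPolynomial σ K)}
    {B : Finset (MvPolynomial σ K)} (hB : IsGroebnerBasis m I B) {f : MvPolynomial σ K}
    (hf : f ∈ I) (h0 : f ≠ 0) :
    ∃ g ∈ B, ∃ (a : σ →₀ ℕ) (c : K) (f' : MvPolynomial σ K), f' ∈ I ∧ f = f' + monomial a c * g ∧
      m.degree f = a + m.degree g ∧ (f' = 0 ∨ m.toSyn (m.degree f') < m.toSyn (m.degree f)) := by
  classical
  have h1 : m.leadingTerm f ∈ Ideal.span ((fun s => monomial s (1 : K)) ''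
      (m.degree '' {g | g ∈ B ∧ g ≠ 0})) := by
    have h2 : m.leadingTerm f ∈ Ideal.span (m.leadingTerm '' (B : Set (MvPolynomial σ K))) :=
      hB.2 ▸ Ideal.subset_span ⟨f, hf, rfl⟩
    refine Ideal.span_le.2 ?_ h2
    rintro _ ⟨g, hg, rfl⟩
    by_cases hg0 : g = 0
    · simp [hg0]
    · rw [MonomialOrder.leadingTerm, ← mul_one (m.leadingCoeff g), ← C_mul_monomial]
      exact Ideal.mul_mem_left _ _ (Ideal.subset_span ⟨_, ⟨g, ⟨hg, hg0⟩, rfl⟩, rfl⟩)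
  rw [mem_ideal_span_monomial_image, m.support_leadingTerm' h0] at h1
  obtain ⟨_, ⟨g, ⟨hg, hg0⟩, rfl⟩, hle⟩ := h1 _ (Finset.mem_singleton_self _)
  set a := m.degree f - m.degree g with ha
  have hag : m.degree f = a + m.degree g := (tsub_add_cancel_of_le hle).symm
  set c := m.leadingCoeff f / m.leadingCoeff g
  have hc : c ≠ 0 := div_ne_zero (m.leadingCoeff_ne_zero_iff.2 h0) (m.leadingCoeff_ne_zero_iff.2 hg0)
  have hd : m.degree (monomial a c * g) = m.degree f := by
    rw [m.degree_mul (by simpa using hc) hg0, m.degree_monomial, if_neg hc, hag]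
  refine ⟨g, hg, a, c, f - monomial a c * g, I.sub_mem hf (I.mul_mem_left _ (hB.1 g hg)),
    by ring, hag, ?_⟩
  by_cases hf' : f - monomial a c * g = 0
  · exact Or.inl hf'
  right
  refine lt_of_le_of_ne ?_ fun h => ?_
  · refine m.degree_sub_le.trans ?_
    rw [hd, sup_idem]
  -- If the degree did not drop, the coefficient there would be nonzero, but `c` was chosen to
  -- cancel it.
  · have h3 := m.leadingCoeff_ne_zero_iff.2 hf'
    apply h3
    rw [MonomialOrder.leadingCoeff, m.toSyn.injective h, coeff_sub, coeff_monomial_mul',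
      if_pos (by rw [hag]; exact le_self_add), ← MonomialOrder.leadingCoeff]
    rw [show m.degree f - a = m.degree g by rw [hag, add_tsub_cancel_left]]
    change _ - c * m.leadingCoeff g = 0
    rw [div_mul_cancel₀ _ (m.leadingCoeff_ne_zero_iff.2 hg0), sub_self]

variable {m : MonomialOrder σ} {I : Ideal (MvPolynomial σ K)} {B : Finset (MvPolynomial σ K)}

/-- Each division step changes the coefficient of `y ^ d` by a multiple of some `initialCoeff y g`.
Allowing any `d` at least the `y`-degree keeps the induction going when the remainder has smaller
`y`-degree. -/
theorem IsGroebnerBasis.variableCoeff_mem_cIdeal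
    (hm : ∀ a b : σ →₀ ℕ, a y < b y → m.toSyn a < m.toSyn b) (hB : IsGroebnerBasis m I B)
    {f : MvPolynomial σ K} (hf : f ∈ I) {d : ℕ} (hd : f.degreeOf y ≤ d) :
    variableCoeff y d f ∈ cIdeal y B := by
  induction hk : m.toSyn (m.degree f) using WellFoundedLT.induction generalizing f with
  | ind k ih =>
    subst hk
    by_cases h0 : f = 0
    · rw [h0, variableCoeff_zero]; exact zero_mem _
    rcases hd.lt_or_eq with hlt | rfl
    · rw [variableCoeff_of_degreeOf_lt y hlt]; exact zero_mem _
    obtain ⟨g, hg, a, c, f', hf', hff, hdeg, hlt⟩ := hB.exists_reduction hf h0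
    have hy : f.degreeOf y = a y + g.degreeOf y := by
      rw [degreeOf_eq_degree_apply hm, degreeOf_eq_degree_apply hm, hdeg, Finsupp.add_apply]
    have h1 : variableCoeff y (f.degreeOf y) f = variableCoeff y (f.degreeOf y) f' +
        monomial (a.erase y) c * initialCoeff y g := by
      conv_lhs => rw [hff, variableCoeff_add, ← hff]
      rw [variableCoeff_monomial_mul y _ _ _ (by omega), hy, Nat.add_sub_cancel_left,
        initialCoeff_eq_variableCoeff]
    rw [h1]
    refine add_mem ?_ (Ideal.mul_mem_left _ _ (Ideal.subset_span ⟨g, hg, rfl⟩))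
    rcases hlt with rfl | hlt
    · rw [variableCoeff_zero]; exact zero_mem _
    · refine ih _ hlt hf' ?_ rfl
      rw [degreeOf_eq_degree_apply hm, degreeOf_eq_degree_apply hm]
      exact not_lt.1 fun h => (hm _ _ h).not_gt hlt

/-- Dividing a polynomial free of `y` only ever uses basis elements free of `y`, since the
`y`-degree adds up in leading exponents. -/
theorem IsGroebnerBasis.mem_nIdeal
    (hm : ∀ a b : σ →₀ ℕ, a y < b y → m.toSyn a < m.toSyn b) (hB : IsGroebnerBasis m I B)
    {f : MvPolynomial σ K} (hf : f ∈ I) (hd : f.degreeOf y = 0) : f ∈ nIdeal y B := by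
  induction hk : m.toSyn (m.degree f) using WellFoundedLT.induction generalizing f with
  | ind k ih =>
    subst hk
    by_cases h0 : f = 0
    · rw [h0]; exact zero_mem _
    obtain ⟨g, hg, a, c, f', hf', hff, hdeg, hlt⟩ := hB.exists_reduction hf h0
    have hy : f.degreeOf y = a y + g.degreeOf y := by
      rw [degreeOf_eq_degree_apply hm, degreeOf_eq_degree_apply hm, hdeg, Finsupp.add_apply]
    have hg0 : g.degreeOf y = 0 := by omega
    rw [hff]
    refine add_mem ?_ (Ideal.mul_mem_left _ _ ?_)
    · rcases hlt with rfl | hlt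
      · exact zero_mem _
      · refine ih _ hlt hf' ?_ rfl
        rw [degreeOf_eq_degree_apply hm] at hd ⊢
        by_contra h
        exact (hm (m.degree f) (m.degree f') (by omega)).not_gt hlt
    · refine Ideal.subset_span ⟨g, ⟨hg, hg0⟩, ?_⟩
      exact initialCoeff_of_degreeOf_eq_zero y hg0

end GroebnerBases

/-! ### Decomposition at a variable that occurs linearly. -/

/-- The ideal of the polynomials `q` such that `y * q + r` is in `I` for some `r`, where `q` and
`r` do not involve `y`. -/
def linearCoeffIdeal {σ : Type u} {K : Type v} [Field K] (y : σ) (I : Ideal (MvPolynomial σ K)) :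
    Ideal (MvPolynomial {x : σ // x ≠ y} K) where
  carrier := {q | ∃ r : MvPolynomial {x : σ // x ≠ y} K,
    X y * rename Subtype.val q + rename Subtype.val r ∈ I}
  add_mem' := by
    rintro a b ⟨r, hr⟩ ⟨r', hr'⟩
    refine ⟨r + r', ?_⟩
    convert I.add_mem hr hr' using 1
    simp only [map_add]; ring
  zero_mem' := ⟨0, by simp⟩
  smul_mem' := by
    rintro c q ⟨r, hr⟩
    refine ⟨c * r, ?_⟩
    convert I.mul_mem_left (rename Subtype.val c) hr using 1
    simp only [smul_eq_mul, map_mul]; ring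

theorem contractIdeal_le_linearCoeffIdeal {σ : Type u} {K : Type v} [Field K] (y : σ)
    (I : Ideal (MvPolynomial σ K)) : contractIdeal y I ≤ linearCoeffIdeal y I := fun q hq =>
  ⟨0, by rw [map_zero, add_zero]; exact I.mul_mem_left _ hq⟩

section LinearDecomposition

variable {σ : Type u} {K : Type v} [Field K] [Finite σ]

/-- A geometric vertex decomposition with respect to a variable that occurs linearly. -/
theorem IsGVD.of_linear {I : Ideal (MvPolynomial σ K)} (unmixed : IsUnmixed I) (y : σ)
    (J : Ideal (MvPolynomial {x : σ // x ≠ y} K))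
    (hlin : J ≤ linearCoeffIdeal y I)
    (hJ : ∀ f ∈ I, initialCoeff y f ∈ J.map (rename (R := K) (Subtype.val : {x // x ≠ y} → σ)))
    (gvd_J : IsGVD J) (gvd_contract : IsGVD (contractIdeal y I)) : IsGVD I := by
  obtain ⟨m, hm⟩ := exists_monomialOrder_apply_lt y
  obtain ⟨B, hB⟩ := exists_isGroebnerBasis m I
  have hc : cIdeal y B = J.map (rename (R := K) (Subtype.val : {x // x ≠ y} → σ)) := by
    apply le_antisymm
    · refine Ideal.span_le.2 ?_
      rintro _ ⟨g, hg, rfl⟩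
      exact hJ g (hB.1 g hg)
    · refine Ideal.map_le_iff_le_comap.2 fun q hq => ?_
      obtain ⟨r, hr⟩ := hlin hq
      have := hB.variableCoeff_mem_cIdeal hm hr (degreeOf_X_mul_add_le y q r)
      rwa [variableCoeff_one_X_mul_add] at this
  have hn : nIdeal y B =
      (contractIdeal y I).map (rename (R := K) (Subtype.val : {x // x ≠ y} → σ)) := by
    apply le_antisymm
    · refine Ideal.span_le.2 ?_
      rintro _ ⟨g, ⟨hg, hg0⟩, rfl⟩
      rw [initialCoeff_of_degreeOf_eq_zero y hg0]
      obtain ⟨q, rfl⟩ := exists_rename_eq_of_degreeOf_eq_zero y hg0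
      exact Ideal.mem_map_of_mem _ (hB.1 _ hg)
    · refine Ideal.map_le_iff_le_comap.2 fun q hq => ?_
      exact hB.mem_nIdeal hm hq (degreeOf_rename_subtypeVal y q)
  refine IsGVD.decomposition I unmixed y m (isCompatibleOrder_of_apply_lt hm) B hB ?_ ?_ ?_
  · rw [hc, hn]
    have hnc : (contractIdeal y I).map (rename (R := K) (Subtype.val : {x // x ≠ y} → σ)) ≤
        J.map (rename (R := K) (Subtype.val : {x // x ≠ y} → σ)) := by
      refine Ideal.map_le_iff_le_comap.2 fun q hq => ?_
      have := hJ _ hq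
      rwa [initialCoeff_of_degreeOf_eq_zero y (degreeOf_rename_subtypeVal y q)] at this
    apply le_antisymm
    · refine Ideal.span_le.2 ?_
      rintro _ ⟨f, hf, rfl⟩
      refine ⟨Ideal.mul_mem_left _ _ (hJ f hf), ?_⟩
      rcases Nat.eq_zero_or_pos (f.degreeOf y) with h0 | h0
      · rw [initialForm_of_degreeOf_eq_zero y h0]
        obtain ⟨q, rfl⟩ := exists_rename_eq_of_degreeOf_eq_zero y h0
        exact Ideal.mem_sup_left (Ideal.mem_map_of_mem _ hf)
      · refine Ideal.mem_sup_right (Ideal.mul_mem_right _ _ ?_)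
        exact Ideal.pow_mem_of_mem _ (Ideal.mem_span_singleton_self _) _ h0
    -- Write the element as `n + y * g` with `n` in `N`. As `N ≤ C`, also `y * g` lies in `C`, hence
    -- so does `g`; then `y * g` is a combination of products `y * q`, each the initial form of some
    -- `y * q + r` in `I`.
    · rintro h ⟨hhC, hhN⟩
      obtain ⟨n, hnN, z, hz, rfl⟩ := Submodule.mem_sup.1 hhN
      obtain ⟨g, rfl⟩ := Ideal.mem_span_singleton.1 hz
      have hg : g ∈ J.map (rename (R := K) (Subtype.val : {x // x ≠ y} → σ)) := by
        refine mem_map_of_X_mul_mem_map y ?_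
        have := Ideal.sub_mem _ hhC (hnc hnN)
        rwa [add_sub_cancel_left] at this
      refine add_mem ?_ ?_
      · refine (Ideal.map_le_iff_le_comap.2 fun q hq => ?_ :
          (contractIdeal y I).map _ ≤ initialFormIdeal y I) hnN
        refine Ideal.subset_span ⟨_, hq, ?_⟩
        exact initialForm_of_degreeOf_eq_zero y (degreeOf_rename_subtypeVal y q)
      · clear hhC hhN hz
        rw [Ideal.map] at hg
        induction hg using Submodule.span_induction with
        | mem x hx =>
          obtain ⟨q, hq, rfl⟩ := hx
          obtain ⟨r, hr⟩ := hlin hq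
          -- For `q = 0` the polynomial `y * q + r` has `y`-degree zero, and its initial form is not
          -- `y * q`.
          by_cases hq0 : q = 0
          · simp [hq0]
          · exact Ideal.subset_span ⟨_, hr, initialForm_X_mul_add y hq0 r⟩
        | zero => simp
        | add a b _ _ ha hb => rw [mul_add]; exact add_mem ha hb
        | smul a x _ hx => rw [smul_eq_mul, mul_left_comm]; exact Ideal.mul_mem_left _ _ hx
  · rwa [hc, contractIdeal_map]
  · rwa [hn, contractIdeal_map]

/-- Here `C` is the unit ideal, so a variable in the ideal can simply be dropped. -/
theorem IsGVD.of_X_mem {I : Ideal (MvPolynomial σ K)} (unmixed : IsUnmixed I) {y : σ}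
    (hy : X y ∈ I) (gvd_contract : IsGVD (contractIdeal y I)) : IsGVD I := by
  refine IsGVD.of_linear unmixed y ⊤ (fun q _ => ⟨0, ?_⟩) (fun f _ => ?_) IsGVD.unit gvd_contract
  · rw [map_zero, add_zero]
    exact I.mul_mem_right _ hy
  · rw [Ideal.map_top]; trivial

end LinearDecomposition
-- Unmixedness of intersections of primes of equal dimension.
section Unmixed

/-- An associated prime is contained in some `Q i` and contains some `Q j`; incomparability forces
it to equal `Q j`. The quotient by the intersection has no larger dimension, because a chain of
primes above the intersection starts above one of the `Q k`. -/
theorem isUnmixed_iInf {R ι : Type*} [CommRing R] [Finite ι] (Q : ι → Ideal R)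
    (hQ : ∀ i, (Q i).IsPrime) (hle : ∀ i j, Q i ≤ Q j → i = j)
    (hdim : ∀ i j, ringKrullDim (R ⧸ Q i) = ringKrullDim (R ⧸ Q j)) :
    IsUnmixed (⨅ i, Q i) := by
  classical
  cases nonempty_fintype ι
  have hmem : ∀ P : Ideal R, P.IsPrime → ⨅ i, Q i ≤ P → ∃ i, Q i ≤ P := by
    intro P hP h
    have h1 : Finset.univ.inf Q ≤ P := by rwa [Finset.inf_univ_eq_iInf]
    obtain ⟨i, -, hi⟩ := (hP.inf_le').1 h1
    exact ⟨i, hi⟩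
  rintro P ⟨hP, x, hx⟩
  obtain ⟨f, rfl⟩ := Ideal.Quotient.mk_surjective x
  -- The associated prime is the radical of the annihilator of the class of `f`, which is why powers
  -- of `r` appear.
  have hcolon : ∀ r, r ∈ P ↔ ∃ n : ℕ, r ^ n * f ∈ ⨅ i, Q i := by
    intro r
    rw [hx, Ideal.mem_radical_iff]
    refine exists_congr fun n => ?_
    rw [Submodule.mem_colon_singleton, Submodule.mem_bot, Algebra.smul_def,
      Ideal.Quotient.algebraMap_eq, ← map_mul, Ideal.Quotient.eq_zero_iff_mem]
  have hf : ∃ i, f ∉ Q i := by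
    by_contra! h
    refine hP.one_notMem ((hcolon 1).2 ⟨0, ?_⟩)
    simpa [Ideal.mem_iInf] using h
  obtain ⟨i, hi⟩ := hf
  have hPi : P ≤ Q i := by
    intro r hr
    obtain ⟨n, hn⟩ := (hcolon r).1 hr
    have := ((hQ i).mem_or_mem ((Ideal.mem_iInf.1 hn) i)).resolve_right hi
    exact (hQ i).mem_of_pow_mem _ this
  obtain ⟨j, hj⟩ := hmem P hP fun r hr => (hcolon r).2 ⟨1, Ideal.mul_mem_right _ _ (by simpa using hr)⟩
  obtain rfl := hle j i (hj.trans hPi)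
  obtain rfl : P = Q j := le_antisymm hPi hj
  apply le_antisymm
  · exact ringKrullDim_le_of_surjective (Ideal.Quotient.factor (iInf_le Q j))
      (Ideal.Quotient.factor_surjective _)
  · rw [ringKrullDim_quotient (⨅ i, Q i)]
    refine iSup_le fun l => ?_
    obtain ⟨k, hk⟩ := hmem l.head.1.asIdeal l.head.1.isPrime l.head.2
    rw [hdim j k, ringKrullDim_quotient]
    let g : Fin (l.length + 1) → PrimeSpectrum.zeroLocus (R := R) (Q k) := fun i =>
      ⟨(l i).1, fun r hr => (l.monotone (Fin.zero_le i) : l 0 ≤ l i) (hk hr)⟩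
    exact Order.LTSeries.length_le_krullDim (⟨l.length, g, fun i => l.step i⟩ :
      LTSeries (PrimeSpectrum.zeroLocus (R := R) (Q k)))

theorem Ideal.IsPrime.isUnmixed {R : Type*} [CommRing R] {P : Ideal R} (hP : P.IsPrime) :
    IsUnmixed P := by
  have := isUnmixed_iInf (fun _ : Unit => P) (fun _ => hP) (fun _ _ _ => rfl) fun _ _ => rfl
  rwa [iInf_const] at this

end Unmixed


/-! ### Kernels of monomial maps, studied through exponent vectors. -/

section MonomialMaps

theorem contractIdeal_ker_aeval {σ : Type u} {K : Type v} [Field K] {A : Type*} [CommRing A]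
    [Algebra K A] (g : σ → A) (y : σ) :
    contractIdeal y (RingHom.ker (aeval (R := K) g)) =
      RingHom.ker (aeval (R := K) fun x : {x // x ≠ y} => g x) := by
  ext f
  rw [contractIdeal, Ideal.mem_comap, RingHom.mem_ker, RingHom.mem_ker, aeval_rename]
  rfl

theorem ker_le_linearCoeffIdeal {σ : Type u} {K : Type v} [Field K] {A : Type*} [CommRing A]
    [Algebra K A] {g : σ → A} (y : σ) :
    RingHom.ker (aeval (R := K) fun x : {x // x ≠ y} => g x) ≤
      linearCoeffIdeal y (RingHom.ker (aeval (R := K) g)) := by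
  rw [← contractIdeal_ker_aeval]
  exact contractIdeal_le_linearCoeffIdeal _ _

/-- The exponent of the monomial `∏ e, (t ^ w e) ^ s e`. -/
noncomputable def exponentMap {σ τ : Type*} (w : σ → τ →₀ ℕ) (s : σ →₀ ℕ) : τ →₀ ℕ :=
  s.sum fun e n => n • w e

variable {σ τ : Type*} {K : Type*} [Field K] {w : σ → τ →₀ ℕ}

theorem exponentMap_add (s t : σ →₀ ℕ) :
    exponentMap w (s + t) = exponentMap w s + exponentMap w t := by
  classical
  exact Finsupp.sum_add_index' (by simp) (by simp [add_smul])

theorem exponentMap_single (e : σ) (n : ℕ) : exponentMap w (Finsupp.single e n) = n • w e := by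
  simp [exponentMap]

theorem exponentMap_apply [Fintype σ] (s : σ →₀ ℕ) (v : τ) :
    exponentMap w s v = ∑ e, s e * w e v := by
  rw [exponentMap, Finsupp.sum_fintype _ _ (by simp), Finsupp.finsetSum_apply]
  simp

theorem aeval_monomial_one (s : σ →₀ ℕ) (c : K) :
    aeval (fun e => monomial (w e) (1 : K)) (monomial s c) = monomial (exponentMap w s) c := by
  rw [aeval_monomial, algebraMap_eq, Finsupp.prod, exponentMap, Finsupp.sum, monomial_sum_index]
  simp_rw [monomial_pow, one_pow]

/-- A linear map that is constant on the monomials of every fibre of a monomial map kills the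
kernel of the monomial map. -/
theorem sum_smul_eq_zero_of_mem_ker {M : Type*} [AddCommGroup M] [Module K M]
    {f : MvPolynomial σ K} (hf : f ∈ RingHom.ker (aeval (R := K) fun e => monomial (w e) (1 : K)))
    (h : (σ →₀ ℕ) → M) (hh : ∀ s ∈ f.support, ∀ t ∈ f.support,
      exponentMap w s = exponentMap w t → h s = h t) :
    ∑ s ∈ f.support, f.coeff s • h s = 0 := by
  classical
  rw [RingHom.mem_ker] at hf
  rw [← Finset.sum_fiberwise_of_maps_to (t := f.support.image (exponentMap w))
    (fun s hs => Finset.mem_image_of_mem _ hs)]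
  refine Finset.sum_eq_zero fun u hu => ?_
  obtain ⟨s, hs, rfl⟩ := Finset.mem_image.1 hu
  have h1 : ∀ t ∈ f.support.filter fun t => exponentMap w t = exponentMap w s,
      f.coeff t • h t = f.coeff t • h s := fun t ht => by
    rw [Finset.mem_filter] at ht
    rw [hh t ht.1 s hs ht.2]
  -- The coefficients of `f` over one fibre sum to the coefficient of the image of `f` at that
  -- monomial, which is zero.
  rw [Finset.sum_congr rfl h1, ← Finset.sum_smul]
  have h2 := congrArg (coeff (exponentMap w s)) hf
  rw [f.as_sum, map_sum, coeff_sum] at h2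
  simp_rw [aeval_monomial_one, coeff_monomial] at h2
  rw [← Finset.sum_filter] at h2
  rw [h2, coeff_zero, zero_smul]

theorem ker_aeval_monomial_eq_bot (hw : Function.Injective (exponentMap w)) :
    RingHom.ker (aeval (R := K) fun e => monomial (w e) (1 : K)) = ⊥ := by
  classical
  rw [eq_bot_iff]
  intro f hf
  have := sum_smul_eq_zero_of_mem_ker hf (fun s => monomial s (1 : K)) fun s _ t _ hst => by
    rw [hw hst]
  rw [Ideal.mem_bot, f.as_sum, ← this]
  exact Finset.sum_congr rfl fun s _ => by rw [smul_monomial, smul_eq_mul, mul_one]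

theorem monomial_sub_monomial_mem_ker {s t : σ →₀ ℕ} (h : exponentMap w s = exponentMap w t) :
    monomial s 1 - monomial t 1 ∈
      RingHom.ker (aeval (R := K) fun e => monomial (w e) (1 : K)) := by
  rw [RingHom.mem_ker, map_sub, aeval_monomial_one, aeval_monomial_one, h, sub_self]

theorem exponentMap_mapDomain {σ' : Type*} (i : σ' → σ) (s : σ' →₀ ℕ) :
    exponentMap w (s.mapDomain i) = exponentMap (fun x => w (i x)) s := by
  rw [exponentMap, Finsupp.sum_mapDomain_index (by simp) (by simp [add_smul])]
  rfl

theorem isGVD_ker_of_injective {σ : Type u} {K : Type v} [Field K] {w : σ → τ →₀ ℕ}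
    (hw : Function.Injective (exponentMap w)) :
    IsGVD (RingHom.ker (aeval (R := K) fun e => monomial (w e) (1 : K))) := by
  refine IsGVD.variables _ (RingHom.ker_isPrime _).isUnmixed ∅ ?_
  rw [ker_aeval_monomial_eq_bot hw]; simp

theorem mapDomain_comapDomain_subtypeVal (y : σ) (s : σ →₀ ℕ) :
    (s.comapDomain (Subtype.val : {x // x ≠ y} → σ) Subtype.val_injective.injOn).mapDomain
      Subtype.val = s.erase y := by
  classical
  ext x
  by_cases hx : x = y
  · subst hx
    rw [Finsupp.mapDomain_of_notMem_range] <;> simp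
  · rw [show x = ((⟨x, hx⟩ : {x // x ≠ y}) : σ) from rfl,
      Finsupp.mapDomain_apply Subtype.val_injective]
    simp [Finsupp.erase_ne hx]

/-- The decomposition of a toric ideal at a variable which occurs linearly. -/
theorem IsGVD.of_toric {σ : Type u} {K : Type v} [Field K] [Finite σ] {w : σ → τ →₀ ℕ} (y : σ)
    (J : Ideal (MvPolynomial {x : σ // x ≠ y} K))
    (hlin : J ≤
      linearCoeffIdeal y (RingHom.ker (aeval (R := K) fun e => monomial (w e) (1 : K))))
    (hker : RingHom.ker (aeval (R := K) fun e : {x // x ≠ y} => monomial (w e) (1 : K)) ≤ J)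
    (hJ : ∀ s t : σ →₀ ℕ, exponentMap w s = exponentMap w t → t y < s y →
      monomial (s.comapDomain Subtype.val Subtype.val_injective.injOn) 1 ∈ J)
    (gvd_J : IsGVD J)
    (gvd_contract :
      IsGVD (RingHom.ker (aeval (R := K) fun e : {x // x ≠ y} => monomial (w e) (1 : K)))) :
    IsGVD (RingHom.ker (aeval (R := K) fun e => monomial (w e) (1 : K))) := by
  classical
  refine IsGVD.of_linear (RingHom.ker_isPrime _).isUnmixed y J hlin (fun f hf => ?_) gvd_J
    (by rwa [contractIdeal_ker_aeval])
  have h3 (s : σ →₀ ℕ) := mapDomain_comapDomain_subtypeVal y s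
  have herase : ∀ s : σ →₀ ℕ, monomial (s.erase y) (1 : K) = rename Subtype.val
      (monomial (s.comapDomain (Subtype.val : {x // x ≠ y} → σ) Subtype.val_injective.injOn)
        (1 : K)) := by
    intro s
    rw [rename_monomial, h3]
  set J' := J.map (rename (R := K) (Subtype.val : {x // x ≠ y} → σ))
  -- Modulo `J'`, the leading `y`-coefficient of `f` is the sum of `f.coeff s • h s`. It vanishes
  -- once `h` is constant on fibres: two monomials with equal `y`-exponent differ, after erasing
  -- `y`, by an element of the smaller kernel; with unequal exponents one gives `0` by `hJ`, the
  -- other since it does not reach the top `y`-degree.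
  let h : (σ →₀ ℕ) → MvPolynomial σ K ⧸ J' := fun s =>
    if s y = f.degreeOf y then Ideal.Quotient.mk J' (monomial (s.erase y) 1) else 0
  have hlt : ∀ s t : σ →₀ ℕ, exponentMap w s = exponentMap w t → t y < s y → h s = 0 := by
    intro s t hst hlt
    simp only [h]
    split_ifs
    · rw [Ideal.Quotient.eq_zero_iff_mem, herase]
      exact Ideal.mem_map_of_mem _ (hJ s t hst hlt)
    · rfl
  have h0 := sum_smul_eq_zero_of_mem_ker hf h fun s hs t ht hst => by
    rcases lt_trichotomy (s y) (t y) with hlt' | heq | hlt'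
    · rw [hlt t s hst.symm hlt']
      have := le_degreeOf_of_mem_support y ht
      exact if_neg (by omega)
    · simp only [h, heq]
      split_ifs
      · rw [Ideal.Quotient.eq, herase, herase, ← map_sub]
        refine Ideal.mem_map_of_mem _ (hker (monomial_sub_monomial_mem_ker ?_))
        rw [← exponentMap_mapDomain Subtype.val, ← exponentMap_mapDomain Subtype.val, h3, h3]
        rw [← Finsupp.erase_add_single y s, ← Finsupp.erase_add_single y t, exponentMap_add,
          exponentMap_add, heq] at hst
        exact add_right_cancel hst
      · rfl
    · rw [hlt s t hst hlt']
      have := le_degreeOf_of_mem_support y hs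
      exact (if_neg (by omega)).symm
  rw [← Ideal.Quotient.eq_zero_iff_mem, ← h0, initialCoeff, map_sum, Finset.sum_filter]
  refine Finset.sum_congr rfl fun s _ => ?_
  simp only [h]
  split_ifs
  · rw [← mul_one (f.coeff s), ← smul_eq_mul, ← smul_monomial, smul_eq_mul, mul_one,
      ← Ideal.Quotient.mkₐ_eq_mk K, map_smul]
  · rw [smul_zero]

/-- If two monomials have the same image and `e` occurs more often in the first one, then through
every vertex of `e` there is a variable that occurs more often in the second one. -/
theorem exists_lt_of_exponentMap_eq [Finite σ] {s t : σ →₀ ℕ}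
    (h : exponentMap w s = exponentMap w t) {e : σ} (he : t e < s e) {v : τ} (hv : w e v ≠ 0) :
    ∃ e', w e' v ≠ 0 ∧ s e' < t e' := by
  cases nonempty_fintype σ
  by_contra! hle
  have := DFunLike.congr_fun h v
  rw [exponentMap_apply, exponentMap_apply] at this
  refine this.not_gt (Finset.sum_lt_sum (fun i _ => ?_) ⟨e, Finset.mem_univ _, ?_⟩)
  · by_cases hi : w i v = 0
    · simp [hi]
    · exact Nat.mul_le_mul_right _ (hle i hi)
  · exact Nat.mul_lt_mul_of_pos_right he (Nat.pos_of_ne_zero hv)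

end MonomialMaps


/-! ### Monomial maps that send the variables in `Z` to zero. -/

section PartialMonomialMaps

variable {σ τ : Type*} {K : Type*} [Field K] {w : σ → τ →₀ ℕ} (Z : Set σ)

open Classical in
-- Let `π` kill the variables in `Z`. Then `f - π f` lies in the ideal they generate, and the full
-- monomial map on `π f` is the partial one on `f`.
theorem ker_aeval_ite_le :
    RingHom.ker (aeval (R := K) fun e => if e ∈ Z then 0 else monomial (w e) (1 : K)) ≤
      RingHom.ker (aeval (R := K) fun e => monomial (w e) (1 : K)) ⊔ Ideal.span (X '' Z) := by
  intro f hf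
  let π : MvPolynomial σ K →ₐ[K] MvPolynomial σ K := aeval fun e => if e ∈ Z then 0 else X e
  have h1 : (aeval (R := K) fun e => monomial (w e) (1 : K)).comp π =
      aeval (R := K) fun e => if e ∈ Z then 0 else monomial (w e) (1 : K) := by
    ext e : 1
    simp only [π, AlgHom.comp_apply, aeval_X]
    split_ifs <;> simp
  have h2 : (Ideal.Quotient.mkₐ K (Ideal.span (X '' Z : Set (MvPolynomial σ K)))).comp π =
      Ideal.Quotient.mkₐ K _ := by
    ext e : 1
    simp only [π, AlgHom.comp_apply, aeval_X]
    split_ifs with he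
    · rw [map_zero]
      exact (Ideal.Quotient.eq_zero_iff_mem.2
        (Ideal.subset_span (Set.mem_image_of_mem X he))).symm
    · rfl
  rw [← add_sub_cancel (π f) f]
  refine add_mem (Ideal.mem_sup_left ?_) (Ideal.mem_sup_right ?_)
  · rw [RingHom.mem_ker] at hf ⊢
    rw [← AlgHom.comp_apply, h1, hf]
  · exact Ideal.Quotient.eq.1 (DFunLike.congr_fun h2 f).symm

open Classical in
theorem aeval_ite_monomial_one (s : σ →₀ ℕ) :
    aeval (fun e => if e ∈ Z then 0 else monomial (w e) (1 : K)) (monomial s (1 : K)) =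
      if ∃ e ∈ Z, s e ≠ 0 then 0 else monomial (exponentMap w s) 1 := by
  split_ifs with h
  · obtain ⟨e, he, hs⟩ := h
    rw [aeval_monomial, Finsupp.prod, Finset.prod_eq_zero (i := e) (by simpa using hs), mul_zero]
    rw [if_pos he, zero_pow hs]
  · rw [← aeval_monomial_one, aeval_monomial, aeval_monomial]
    congr 1
    refine Finset.prod_congr rfl fun e he => ?_
    simp only [if_neg fun hZ => h ⟨e, hZ, by simpa using he⟩]

open Classical in
-- When involving a variable of `Z` is a property of the whole fibre, the partial map is constant on
-- fibres.
theorem ker_le_ker_aeval_ite (hZ : ∀ s t : σ →₀ ℕ, exponentMap w s = exponentMap w t →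
      (∃ e ∈ Z, s e ≠ 0) → ∃ e ∈ Z, t e ≠ 0) :
    RingHom.ker (aeval (R := K) fun e => monomial (w e) (1 : K)) ≤
      RingHom.ker (aeval (R := K) fun e => if e ∈ Z then 0 else monomial (w e) (1 : K)) := by
  intro f hf
  have := sum_smul_eq_zero_of_mem_ker hf (fun s =>
    aeval (fun e => if e ∈ Z then 0 else monomial (w e) (1 : K)) (monomial s (1 : K)))
    fun s _ t _ hst => by
      simp only [aeval_ite_monomial_one, hst]
      rw [if_congr ⟨hZ s t hst, hZ t s hst.symm⟩ rfl rfl]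
  rw [RingHom.mem_ker]
  refine Eq.trans ?_ this
  conv_lhs => rw [f.as_sum, map_sum]
  refine Finset.sum_congr rfl fun s _ => ?_
  rw [← map_smul, smul_monomial, smul_eq_mul, mul_one]

end PartialMonomialMaps

/-! ### Bipartite graphs as row nested diagrams. -/

section RowNested

/-- The columns which meet a given row are nested above this row. -/
def IsRowNested (S : Set (ℕ × ℕ)) : Prop :=
  ∀ i j j', (i, j) ∈ S → (i, j') ∈ S →
    (∀ i' < i, (i', j) ∈ S → (i', j') ∈ S) ∨ (∀ i' < i, (i', j') ∈ S → (i', j) ∈ S)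

theorem IsRowNested.delete {S : Set (ℕ × ℕ)} (hS : IsRowNested S) {i₀ j₀ : ℕ}
    (hmax : ∀ p ∈ S, p.1 ≤ i₀) : IsRowNested {p | p ∈ S ∧ p ≠ (i₀, j₀)} := by
  rintro i j j' ⟨h1, -⟩ ⟨h2, -⟩
  have := hmax _ h1
  have hne : ∀ i' < i, ∀ k, ((i', k) : ℕ × ℕ) ≠ (i₀, j₀) := by
    rintro i' hi' k h
    simp only [Prod.mk.injEq] at h
    simp only at this; omega
  exact (hS i j j' h1 h2).imp (fun h i' hi' hj => ⟨h i' hi' hj.1, hne i' hi' _⟩)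
    (fun h i' hi' hj => ⟨h i' hi' hj.1, hne i' hi' _⟩)

/-- For a cell that survives above row `i₀`, nothing in its column is removed there, so nesting is
inherited. A surviving cell of row `i₀` has lost every cell above it, and nesting is vacuous. -/
theorem IsRowNested.link {S : Set (ℕ × ℕ)} (hS : IsRowNested S) {i₀ j₀ : ℕ}
    (hmax : ∀ p ∈ S, p.1 ≤ i₀) : IsRowNested {p | p ∈ S ∧ p ≠ (i₀, j₀) ∧
      ¬(p.1 < i₀ ∧ (i₀, p.2) ∈ S ∧ p.2 ≠ j₀)} := by
  rintro i j j' ⟨h1, h1', h1''⟩ ⟨h2, h2', h2''⟩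
  have := hmax _ h1
  simp only at this h1'' h2''
  rcases this.lt_or_eq with hi | rfl
  · have hne : ∀ i' < i, ∀ k, ((i', k) : ℕ × ℕ) ≠ (i₀, j₀) := by
      rintro i' hi' k h
      simp only [Prod.mk.injEq] at h
      omega
    exact (hS i j j' h1 h2).imp
      (fun h i' hi' hj => ⟨h i' hi' hj.1, hne i' hi' _, fun H => h2'' ⟨hi, H.2⟩⟩)
      (fun h i' hi' hj => ⟨h i' hi' hj.1, hne i' hi' _, fun H => h1'' ⟨hi, H.2⟩⟩)
  · left
    intro i' hi' hj
    exact absurd ⟨hi', h1, fun h => h1' (Prod.ext rfl h)⟩ hj.2.2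

/-- The exponent of `x_i * y_j`. -/
noncomputable def pairExponent (p : ℕ × ℕ) : ℕ ⊕ ℕ →₀ ℕ :=
  Finsupp.single (.inl p.1) 1 + Finsupp.single (.inr p.2) 1

theorem pairExponent_inl {p : ℕ × ℕ} {i : ℕ} : pairExponent p (.inl i) ≠ 0 ↔ p.1 = i := by
  simp [pairExponent, Finsupp.single_apply]

theorem pairExponent_inr {p : ℕ × ℕ} {j : ℕ} : pairExponent p (.inr j) ≠ 0 ↔ p.2 = j := by
  simp [pairExponent, Finsupp.single_apply]

theorem exists_row_lt {σ : Type*} [Finite σ] {lab : σ → ℕ × ℕ} {s t : σ →₀ ℕ}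
    (h : exponentMap (fun e => pairExponent (lab e)) s =
      exponentMap (fun e => pairExponent (lab e)) t) {e : σ} (he : t e < s e) :
    ∃ e', (lab e').1 = (lab e).1 ∧ s e' < t e' := by
  obtain ⟨e', h1, h2⟩ := exists_lt_of_exponentMap_eq h he (pairExponent_inl.2 rfl)
  exact ⟨e', pairExponent_inl.1 h1, h2⟩

theorem exists_column_lt {σ : Type*} [Finite σ] {lab : σ → ℕ × ℕ} {s t : σ →₀ ℕ}
    (h : exponentMap (fun e => pairExponent (lab e)) s =
      exponentMap (fun e => pairExponent (lab e)) t) {e : σ} (he : t e < s e) :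
    ∃ e', (lab e').2 = (lab e).2 ∧ s e' < t e' := by
  obtain ⟨e', h1, h2⟩ := exists_lt_of_exponentMap_eq h he (pairExponent_inr.2 rfl)
  exact ⟨e', pairExponent_inr.1 h1, h2⟩

open Classical in
-- The set `Z` of killed variables is part of the statement because the ideal `C` of the
-- decomposition is a toric ideal of a smaller diagram together with variables.
theorem isGVD_of_isRowNested {K : Type v} [Field K] (n : ℕ) {σ : Type u} [Finite σ]
    (hn : Nat.card σ = n) (lab : σ → ℕ × ℕ) (Z : Set σ) (hinj : Set.InjOn lab Zᶜ)
    (hS : IsRowNested (lab '' Zᶜ)) :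
    IsGVD (RingHom.ker (aeval (R := K) fun e =>
      if e ∈ Z then 0 else monomial (pairExponent (lab e)) (1 : K))) := by
  induction n using Nat.strong_induction_on generalizing σ with
  | _ n ih =>
  subst hn
  have hcard : ∀ y : σ, Nat.card {x // x ≠ y} < Nat.card σ := fun y =>
    Finite.card_subtype_lt (x := y) (by simp)
  by_cases hZ : Z.Nonempty
  · obtain ⟨y, hy⟩ := hZ
    refine IsGVD.of_X_mem (RingHom.ker_isPrime _).isUnmixed (y := y) ?_ ?_
    · rw [RingHom.mem_ker, aeval_X, if_pos hy]
    · rw [contractIdeal_ker_aeval]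
      refine ih _ (hcard y) rfl (fun x => lab x) (Subtype.val ⁻¹' Z) ?_ ?_
      · intro a ha b hb hab
        exact Subtype.ext (hinj ha hb hab)
      · convert hS using 1
        ext p
        constructor
        · rintro ⟨a, ha, rfl⟩
          exact ⟨a, ha, rfl⟩
        · rintro ⟨a, ha, rfl⟩
          exact ⟨⟨a, fun h => ha (h ▸ hy)⟩, ha, rfl⟩
  obtain rfl : Z = ∅ := Set.not_nonempty_iff_eq_empty.1 hZ
  simp only [Set.mem_empty_iff_false, if_false]
  rw [Set.compl_empty, Set.injOn_univ] at hinj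
  rw [Set.compl_empty, Set.image_univ] at hS
  rcases isEmpty_or_nonempty σ with hσ | hσ
  · exact isGVD_ker_of_injective (K := K) (w := fun e => pairExponent (lab e)) (Function.injective_of_subsingleton _)
  obtain ⟨y₁, hy₁⟩ := Finite.exists_max fun e => (lab e).1
  set S := Set.range lab with hSdef
  -- `c j` records the cells of column `j` above the last row. The variable `y` is a cell of the
  -- last row whose column has the most of them; by nesting its column then contains those of all
  -- the others, which is `hcol`.
  let c : ℕ → Set ℕ := fun j => {i | i < (lab y₁).1 ∧ (i, j) ∈ S}
  have hc : ∀ j, (c j).Finite := fun j => (Set.finite_Iio _).subset fun i hi => hi.1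
  have : Nonempty {e // (lab e).1 = (lab y₁).1} := ⟨⟨y₁, rfl⟩⟩
  obtain ⟨⟨y, hy⟩, hmax⟩ := Finite.exists_max fun e : {e // (lab e).1 = (lab y₁).1} =>
    (c (lab e).2).ncard
  rw [← hy] at hy₁
  have hmaxS : ∀ p ∈ S, p.1 ≤ (lab y).1 := by
    rintro _ ⟨e, rfl⟩; exact hy₁ e
  have hcol : ∀ e, (lab e).1 = (lab y).1 → ∀ i < (lab y).1, (i, (lab e).2) ∈ S →
      (i, (lab y).2) ∈ S := by
    intro e he i hi hie
    rcases hS (lab y).1 (lab e).2 (lab y).2 ⟨e, by rw [← he]⟩ ⟨y, rfl⟩ with h | h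
    · exact h i hi hie
    · have h1 : c (lab y).2 ⊆ c (lab e).2 := fun i' hi' => ⟨hi'.1, h i' (hy ▸ hi'.1) hi'.2⟩
      have h2 := Set.eq_of_subset_of_ncard_le h1 (hmax ⟨e, he.trans hy⟩) (hc _)
      have h3 : i ∈ c (lab e).2 := ⟨hy ▸ hi, hie⟩
      rw [← h2] at h3
      exact h3.2
  -- `Z'` consists of the cells above the last row, in the other columns that meet the last row.
  -- Each is a corner opposite to `y` of a rectangle of cells, hence a coefficient of `y` in a
  -- quadratic binomial.
  obtain ⟨Z', hZ'⟩ : ∃ Z' : Set {x // x ≠ y}, ∀ e, e ∈ Z' ↔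
    (lab e).1 < (lab y).1 ∧ ((lab y).1, (lab e).2) ∈ S ∧ (lab e).2 ≠ (lab y).2 :=
    ⟨{e | _}, fun _ => Iff.rfl⟩
  refine IsGVD.of_toric (w := fun e => pairExponent (lab e)) y (RingHom.ker (aeval (R := K) fun e : {x // x ≠ y} =>
    if e ∈ Z' then 0 else monomial (pairExponent (lab e)) (1 : K))) ?_ ?_ ?_ ?_ ?_
  · refine (ker_aeval_ite_le (w := fun e : {x // x ≠ y} => pairExponent (lab e)) Z').trans
      (sup_le ?_ (Ideal.span_le.2 ?_))
    · exact ker_le_linearCoeffIdeal (g := fun e => monomial (pairExponent (lab e)) (1 : K)) y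
    · rintro _ ⟨e, he, rfl⟩
      obtain ⟨he1, ⟨e₁, he₁⟩, he3⟩ := (hZ' e).1 he
      have h4 : ((lab e).1, (lab y).2) ∈ S :=
        hcol e₁ (by rw [he₁]) _ he1 ⟨e, by rw [he₁]⟩
      obtain ⟨e₂, he₂⟩ := h4
      have h5 : e₁ ≠ y := by
        rintro rfl; exact he3 (by rw [he₁])
      have h6 : e₂ ≠ y := by
        rintro rfl
        have := congrArg Prod.fst he₂
        simp only at this; omega
      refine ⟨-(X ⟨e₁, h5⟩ * X ⟨e₂, h6⟩), ?_⟩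
      rw [RingHom.mem_ker]
      simp only [map_add, map_mul, map_neg, rename_X, aeval_X, monomial_mul, he₁, he₂]
      rw [add_neg_eq_zero]
      congr 2
      simp only [pairExponent]
      abel
  · refine ker_le_ker_aeval_ite Z' ?_
    rintro s t hst ⟨e, he, hse⟩
    obtain ⟨he1, he2, he3⟩ := (hZ' e).1 he
    -- If `t` avoids `Z'`, the exchange in the column of `e` must land in the last row. An exchange
    -- in that row, then one in the new column, leads to a cell of `Z'` occurring in `t`; the new
    -- column is not that of `y`, since `y` has been removed.
    by_contra! ht
    have key : ∀ f : {x // x ≠ y}, (lab f).1 ≠ (lab y).1 → ((lab y).1, (lab f).2) ∈ S →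
        (lab f).2 ≠ (lab y).2 → t f = 0 := fun f h1 h2 h3 =>
      Nat.le_zero.1 (ht f ((hZ' f).2 ⟨lt_of_le_of_ne (hy₁ f) h1, h2, h3⟩)).le
    obtain ⟨e', h1, h2⟩ := exists_column_lt (lab := fun x : {x // x ≠ y} => lab x) hst
      (e := e) (by rw [key e he1.ne he2 he3]; omega)
    have h3 : (lab e').1 = (lab y).1 := by
      by_contra h
      have := key e' h (by rwa [h1]) (by rwa [h1])
      omega
    obtain ⟨e'', h4, h5⟩ := exists_row_lt (lab := fun x : {x // x ≠ y} => lab x) hst.symm h2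
    rw [h3] at h4
    have h6 : (lab e'').2 ≠ (lab y).2 := fun h => e''.2 (hinj (Prod.ext h4 h))
    obtain ⟨f, h7, h8⟩ := exists_column_lt (lab := fun x : {x // x ≠ y} => lab x) hst h5
    by_cases h9 : (lab f).1 = (lab y).1
    · have : f = e'' := Subtype.ext (hinj (Prod.ext (h9.trans h4.symm) h7))
      subst this; omega
    · have := key f h9 ⟨e'', Prod.ext h4 h7.symm⟩ (by rwa [h7])
      omega
  · intro s t hst hlt
    rw [RingHom.mem_ker, aeval_ite_monomial_one, if_pos]
    -- An exchange in the row of `y`, followed by one in the resulting column, reaches a cell of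
    -- `Z'` in `s`.
    obtain ⟨e', h1, h2⟩ := exists_row_lt hst hlt
    obtain ⟨e, h3, h4⟩ := exists_column_lt hst.symm h2
    have h5 : (lab e').2 ≠ (lab y).2 := fun h => by
      have := hinj (Prod.ext h1 h); subst this; omega
    have h6 : e ≠ y := by
      rintro rfl; exact h5 h3.symm
    have h7 : (lab e).1 ≠ (lab y).1 := fun h => by
      have := hinj (Prod.ext (h.trans h1.symm) h3); subst this; omega
    refine ⟨⟨e, h6⟩, (hZ' _).2 ⟨lt_of_le_of_ne (hy₁ e) h7, ⟨e', Prod.ext h1 h3.symm⟩,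
      by rwa [h3]⟩, ?_⟩
    simp only [Finsupp.comapDomain_apply]
    omega
  · refine ih _ (hcard y) rfl (fun x => lab x) Z' ?_ ?_
    · intro a _ b _ hab
      exact Subtype.ext (hinj hab)
    · convert hS.link (j₀ := (lab y).2) hmaxS using 1
      ext p
      constructor
      · rintro ⟨a, ha, rfl⟩
        exact ⟨⟨a, rfl⟩, fun h => a.2 (hinj h), fun h => ha ((hZ' a).2 h)⟩
      · rintro ⟨⟨a, rfl⟩, h1, h2⟩
        exact ⟨⟨a, fun h => h1 (by rw [h])⟩, fun h => h2 ((hZ' _).1 h), rfl⟩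
  · have := ih _ (hcard y) rfl (fun x : {x // x ≠ y} => lab x) ∅ ?_ ?_
    · simpa only [Set.mem_empty_iff_false, if_false] using this
    · intro a _ b _ hab
      exact Subtype.ext (hinj hab)
    · convert hS.delete (j₀ := (lab y).2) hmaxS using 1
      ext p
      constructor
      · rintro ⟨a, ha, rfl⟩
        exact ⟨⟨a, rfl⟩, fun h => a.2 (hinj h)⟩
      · rintro ⟨⟨a, rfl⟩, h1⟩
        exact ⟨⟨a, fun h => h1 (by rw [h])⟩, by simp, rfl⟩

end RowNested


/-! ### Ideals generated by variables and one squarefree monomial. -/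

section VariableIdeals

/-- The ideal is the kernel of the map that kills the variables in `s` and fixes the others. -/
theorem isPrime_span_X_image {σ : Type*} {K : Type*} [Field K] (s : Set σ) :
    (Ideal.span (X '' s : Set (MvPolynomial σ K))).IsPrime := by
  classical
  have h := ker_aeval_ite_le (K := K) (w := fun e : σ => Finsupp.single e 1) s
  have hinj : RingHom.ker (aeval (R := K) fun e : σ => monomial (Finsupp.single e 1) (1 : K)) = ⊥ := by
    refine ker_aeval_monomial_eq_bot fun a b hab => ?_
    have : ∀ c : σ →₀ ℕ, exponentMap (fun e : σ => Finsupp.single e 1) c = c := fun c => by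
      simp [exponentMap]
    rwa [this, this] at hab
  rw [hinj, bot_sup_eq] at h
  rw [← h.antisymm (Ideal.span_le.2 ?_)]
  · exact RingHom.ker_isPrime _
  · rintro _ ⟨e, he, rfl⟩
    rw [SetLike.mem_coe, RingHom.mem_ker, aeval_X, if_pos he]

variable {σ : Type u} {K : Type v} [Field K]

/-- The intersection of the ideals `⟨X e⟩ + ⟨X z | z ∈ Z⟩` for `e ∈ T`: the ideal generated by the
variables in `Z` and the product of the variables in `T`. -/
noncomputable def squarefreeIdeal (K : Type v) [Field K] (Z T : Set σ) : Ideal (MvPolynomial σ K) :=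
  ⨅ e : T, Ideal.span (X '' insert (e : σ) Z)

theorem mem_squarefreeIdeal {Z T : Set σ} {f : MvPolynomial σ K} :
    f ∈ squarefreeIdeal K Z T ↔
      ∀ s ∈ f.support, (∃ z ∈ Z, s z ≠ 0) ∨ ∀ e ∈ T, s e ≠ 0 := by
  simp only [squarefreeIdeal, Ideal.mem_iInf, mem_ideal_span_X_image, Set.mem_insert_iff,
    exists_eq_or_imp, Subtype.forall]
  grind

theorem monomial_mem_squarefreeIdeal {Z T : Set σ} {s : σ →₀ ℕ} (c : K)
    (h : (∃ z ∈ Z, s z ≠ 0) ∨ ∀ e ∈ T, s e ≠ 0) : monomial s c ∈ squarefreeIdeal K Z T := by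
  rw [mem_squarefreeIdeal]
  intro t ht
  rwa [Finset.mem_singleton.1 (support_monomial_subset ht)]

theorem squarefreeIdeal_le {Z T : Set σ} {J : Ideal (MvPolynomial σ K)}
    (hZ : ∀ z ∈ Z, X z ∈ J) (u : σ →₀ ℕ) (hu : ∀ s : σ →₀ ℕ, (∀ e ∈ T, s e ≠ 0) → u ≤ s)
    (huJ : monomial u 1 ∈ J) : squarefreeIdeal K Z T ≤ J := by
  intro f hf
  rw [mem_squarefreeIdeal] at hf
  rw [f.as_sum]
  refine sum_mem fun s hs => ?_
  rcases hf s hs with ⟨z, hz, hsz⟩ | h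
  · refine J.mem_of_dvd ?_ (hZ z hz)
    rw [X, monomial_dvd_monomial]
    exact ⟨Or.inr (by simpa [Nat.one_le_iff_ne_zero] using hsz), one_dvd _⟩
  · refine J.mem_of_dvd ?_ huJ
    rw [monomial_dvd_monomial]
    exact ⟨Or.inr (hu s h), one_dvd _⟩

/-- Swapping two variables of `T` carries one component to another, so all components have the same
dimension. -/
theorem isUnmixed_squarefreeIdeal [Finite σ] {Z T : Set σ} (hZT : Disjoint Z T) :
    IsUnmixed (squarefreeIdeal K Z T) := by
  classical
  have hT : ∀ e : T, (e : σ) ∉ Z := fun e he => Set.disjoint_left.1 hZT he e.2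
  refine isUnmixed_iInf _ (fun e => isPrime_span_X_image _) (fun e e' h => ?_) fun e e' => ?_
  · have h1 := h (Ideal.subset_span (Set.mem_image_of_mem X (Set.mem_insert _ _)))
    rw [mem_ideal_span_X_image] at h1
    obtain ⟨i, hi, hne⟩ := h1 (Finsupp.single e 1) (by simp [X])
    have h2 : i = e := by
      by_contra h3
      exact hne (Finsupp.single_eq_of_ne h3)
    rw [h2] at hi
    exact Subtype.ext (hi.resolve_right (hT e))
  · refine ringKrullDim_eq_of_ringEquiv (Ideal.quotientEquiv _ _
      (renameEquiv K (Equiv.swap (e : σ) e')).toRingEquiv ?_)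
    rw [Ideal.map_span]
    congr 1
    rw [Set.image_image, Set.image_insert_eq, Set.image_insert_eq]
    congr 1
    · simp
    · refine Set.image_congr fun z hz => ?_
      have h1 : z ≠ e := fun h => hT e (h ▸ hz)
      have h2 : z ≠ e' := fun h => hT e' (h ▸ hz)
      simp [Equiv.swap_apply_of_ne_of_ne h1 h2]

/-- At a variable `y` of `T`, the ideal `C` loses the factor `y` from the product, and the
contraction keeps only the variables in `Z`. With `T` empty the intersection is the unit ideal. -/
theorem isGVD_squarefreeIdeal (n : ℕ) {σ : Type u} [Finite σ] (hn : Nat.card σ = n)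
    {Z T : Set σ} (hZT : Disjoint Z T) : IsGVD (squarefreeIdeal K Z T) := by
  induction n using Nat.strong_induction_on generalizing σ with
  | _ n ih =>
  subst hn
  rcases T.eq_empty_or_nonempty with rfl | ⟨y, hy⟩
  · rw [squarefreeIdeal, iInf_of_empty]
    exact IsGVD.unit
  have hyZ : y ∉ Z := fun h => Set.disjoint_left.1 hZT h hy
  refine IsGVD.of_linear (isUnmixed_squarefreeIdeal hZT) y
    (squarefreeIdeal K (Subtype.val ⁻¹' Z) (Subtype.val ⁻¹' T)) ?_ ?_ ?_ ?_
  · intro q hq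
    rw [mem_squarefreeIdeal] at hq
    rw [q.as_sum]
    refine sum_mem fun s hs => ⟨0, ?_⟩
    rw [map_zero, add_zero, rename_monomial, X, monomial_mul]
    have hval : ∀ x : {x // x ≠ y}, (Finsupp.single y 1 + s.mapDomain Subtype.val : σ →₀ ℕ) x = s x := by
      intro x
      rw [Finsupp.add_apply, Finsupp.mapDomain_apply Subtype.val_injective,
        Finsupp.single_eq_of_ne x.2, zero_add]
    refine monomial_mem_squarefreeIdeal _ ?_
    rcases hq s hs with ⟨z, hz, hsz⟩ | h
    · exact Or.inl ⟨z, hz, by rwa [hval]⟩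
    · refine Or.inr fun e he => ?_
      by_cases hey : e = y
      · simp [hey]
      · rw [hval ⟨e, hey⟩]
        exact h _ he
  · intro f hf
    rw [mem_squarefreeIdeal] at hf
    rw [initialCoeff]
    refine sum_mem fun s hs => ?_
    rw [← mapDomain_comapDomain_subtypeVal, ← rename_monomial]
    refine Ideal.mem_map_of_mem _ (monomial_mem_squarefreeIdeal _ ?_)
    refine (hf s (Finset.mem_filter.1 hs).1).imp ?_ fun h e he => h e he
    rintro ⟨z, hz, hsz⟩
    exact ⟨⟨z, fun h => hyZ (h ▸ hz)⟩, hz, hsz⟩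
  · exact ih _ (Finite.card_subtype_lt (x := y) (by simp)) rfl (hZT.preimage _)
  · have : contractIdeal y (squarefreeIdeal K Z T) = Ideal.span (X '' (Subtype.val ⁻¹' Z)) := by
      ext f
      classical
      change rename Subtype.val f ∈ squarefreeIdeal K Z T ↔ _
      rw [mem_squarefreeIdeal, mem_ideal_span_X_image,
        support_rename_of_injective Subtype.val_injective, Finset.forall_mem_image]
      refine forall₂_congr fun s _ => ⟨?_, ?_⟩
      · rintro (⟨z, hz, hsz⟩ | h)
        · refine ⟨⟨z, fun h => hyZ (h ▸ hz)⟩, hz, ?_⟩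
          rwa [← Finsupp.mapDomain_apply Subtype.val_injective]
        · exact absurd (Finsupp.mapDomain_of_notMem_range _ _ (by simp)) (h y hy)
      · rintro ⟨z, hz, hsz⟩
        exact Or.inl ⟨z, hz, by rwa [Finsupp.mapDomain_apply Subtype.val_injective]⟩
    rw [this]
    exact IsGVD.variables _ (isPrime_span_X_image _).isUnmixed _ rfl

end VariableIdeals


/-! ### Exponents of edges, and labels for a path with doubly joined ends. -/

section Sym2Exponent

/-- The exponent of `x_a * x_b`, for an unordered pair `{a, b}`. -/
noncomputable def sym2Exponent {W : Type*} : Sym2 W → W →₀ ℕ :=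
  Sym2.lift ⟨fun a b => Finsupp.single a 1 + Finsupp.single b 1, fun _ _ => add_comm _ _⟩

theorem sym2Exponent_mk {W : Type*} (a b : W) :
    sym2Exponent s(a, b) = Finsupp.single a 1 + Finsupp.single b 1 := rfl

theorem sym2Exponent_ne_zero {W : Type*} {p : Sym2 W} {v : W} :
    sym2Exponent p v ≠ 0 ↔ v ∈ p := by
  classical
  induction p using Sym2.ind with
  | _ a b =>
    rw [sym2Exponent_mk, Sym2.mem_iff, Finsupp.add_apply, Finsupp.single_apply,
      Finsupp.single_apply]
    split_ifs <;> simp_all [eq_comm]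

end Sym2Exponent

/-- Labels for the edges of a path `p_0, …, p_L` whose ends are also joined through vertices
`q_i`: the edges `{p_0, q_i}`, `{p_L, q_i}` and `{p_k, p_{k+1}}`. -/
inductive PathLabel : Type
  | left (i : ℕ)
  | right (i : ℕ)
  | step (k : ℕ)

/-- The two ends of an edge; the vertices are `p_k = inl k` and `q_i = inr i`. -/
def PathLabel.ends (L : ℕ) : PathLabel → Sym2 (ℕ ⊕ ℕ)
  | .left i => s(.inl 0, .inr i)
  | .right i => s(.inl L, .inr i)
  | .step k => s(.inl k, .inl (k + 1))

/-! ### Alternating walks between two monomials with equal image. -/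

section PathFibres

open PathLabel

variable {σ : Type*} [Finite σ] {L : ℕ} {lab : σ → PathLabel} {s t : σ →₀ ℕ} {e : σ}

theorem exists_lt_of_mem_ends
    (h : exponentMap (fun e => sym2Exponent ((lab e).ends L)) s =
      exponentMap (fun e => sym2Exponent ((lab e).ends L)) t) (he : t e < s e) {v : ℕ ⊕ ℕ}
    (hv : v ∈ (lab e).ends L) : ∃ e', v ∈ (lab e').ends L ∧ s e' < t e' := by
  obtain ⟨e', h1, h2⟩ := exists_lt_of_exponentMap_eq h he (sym2Exponent_ne_zero.2 hv)
  exact ⟨e', sym2Exponent_ne_zero.1 h1, h2⟩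

theorem inr_mem_ends {l : PathLabel} {i : ℕ} :
    .inr i ∈ l.ends L ↔ l = left i ∨ l = right i := by
  cases l <;> simp [PathLabel.ends, eq_comm]

theorem inl_mem_ends {l : PathLabel} {k : ℕ} :
    .inl k ∈ l.ends L ↔ (k = 0 ∧ ∃ i, l = left i) ∨ (k = L ∧ ∃ i, l = right i) ∨ l = step k ∨
      ∃ k', k = k' + 1 ∧ l = step k' := by
  cases l <;> simp [PathLabel.ends]
  grind

/-- Only two edges meet at `q_i`, so the exchange there has a unique outcome. The same reasoning
moves along the inner vertices of the path. -/
theorem exists_right_lt (hinj : Function.Injective lab)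
    (h : exponentMap (fun e => sym2Exponent ((lab e).ends L)) s =
      exponentMap (fun e => sym2Exponent ((lab e).ends L)) t)
    {i : ℕ} (hl : lab e = left i) (he : t e < s e) :
    ∃ e', lab e' = right i ∧ s e' < t e' := by
  obtain ⟨e', h1, h2⟩ := exists_lt_of_mem_ends h he (v := .inr i) (inr_mem_ends.2 (Or.inl hl))
  rcases inr_mem_ends.1 h1 with h3 | h3
  · obtain rfl := hinj (h3.trans hl.symm); omega
  · exact ⟨e', h3, h2⟩

theorem exists_left_lt (hinj : Function.Injective lab)
    (h : exponentMap (fun e => sym2Exponent ((lab e).ends L)) s =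
      exponentMap (fun e => sym2Exponent ((lab e).ends L)) t)
    {i : ℕ} (hl : lab e = right i) (he : t e < s e) :
    ∃ e', lab e' = left i ∧ s e' < t e' := by
  obtain ⟨e', h1, h2⟩ := exists_lt_of_mem_ends h he (v := .inr i) (inr_mem_ends.2 (Or.inr hl))
  rcases inr_mem_ends.1 h1 with h3 | h3
  · exact ⟨e', h3, h2⟩
  · obtain rfl := hinj (h3.trans hl.symm); omega

theorem exists_step_succ_lt (hinj : Function.Injective lab)
    (h : exponentMap (fun e => sym2Exponent ((lab e).ends L)) s =
      exponentMap (fun e => sym2Exponent ((lab e).ends L)) t)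
    {k : ℕ} (hk : k + 1 < L) (hl : lab e = step k) (he : t e < s e) :
    ∃ e', lab e' = step (k + 1) ∧ s e' < t e' := by
  obtain ⟨e', h1, h2⟩ := exists_lt_of_mem_ends h he (v := .inl (k + 1))
    (inl_mem_ends.2 (by simp [hl]))
  rcases inl_mem_ends.1 h1 with ⟨h3, -⟩ | ⟨h3, -⟩ | h3 | ⟨k', hk', h3⟩
  · omega
  · omega
  · exact ⟨e', h3, h2⟩
  · obtain rfl : k = k' := by omega
    obtain rfl := hinj (h3.trans hl.symm); omega

theorem exists_step_pred_lt (hinj : Function.Injective lab)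
    (h : exponentMap (fun e => sym2Exponent ((lab e).ends L)) s =
      exponentMap (fun e => sym2Exponent ((lab e).ends L)) t)
    {k : ℕ} (hk : k + 1 < L) (hl : lab e = step (k + 1)) (he : t e < s e) :
    ∃ e', lab e' = step k ∧ s e' < t e' := by
  obtain ⟨e', h1, h2⟩ := exists_lt_of_mem_ends h he (v := .inl (k + 1))
    (inl_mem_ends.2 (by simp [hl]))
  rcases inl_mem_ends.1 h1 with ⟨h3, -⟩ | ⟨h3, -⟩ | h3 | ⟨k', hk', h3⟩
  · omega
  · omega
  · obtain rfl := hinj (h3.trans hl.symm); omega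
  · obtain rfl : k = k' := by omega
    exact ⟨e', h3, h2⟩

theorem exists_right_lt_of_step (hinj : Function.Injective lab)
    (hrange : ∀ e k, lab e = step k → k < L)
    (h : exponentMap (fun e => sym2Exponent ((lab e).ends L)) s =
      exponentMap (fun e => sym2Exponent ((lab e).ends L)) t)
    {k : ℕ} (hk : k + 1 = L) (hl : lab e = step k) (he : t e < s e) :
    ∃ e' i, lab e' = right i ∧ s e' < t e' := by
  obtain ⟨e', h1, h2⟩ := exists_lt_of_mem_ends h he (v := .inl (k + 1))
    (inl_mem_ends.2 (by simp [hl]))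
  rcases inl_mem_ends.1 h1 with ⟨h3, -⟩ | ⟨-, i, h3⟩ | h3 | ⟨k', hk', h3⟩
  · omega
  · exact ⟨e', i, h3, h2⟩
  · have := hrange e' _ h3; omega
  · obtain rfl : k = k' := by omega
    obtain rfl := hinj (h3.trans hl.symm); omega

theorem exists_right_or_step_lt (hL : 0 < L) (hrange : ∀ e k, lab e = step k → k < L)
    (h : exponentMap (fun e => sym2Exponent ((lab e).ends L)) s =
      exponentMap (fun e => sym2Exponent ((lab e).ends L)) t)
    {i : ℕ} (hl : lab e = right i) (he : t e < s e) :
    ∃ e', ((∃ j, lab e' = right j) ∨ ∃ k, k + 1 = L ∧ lab e' = step k) ∧ s e' < t e' := by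
  obtain ⟨e', h1, h2⟩ := exists_lt_of_mem_ends h he (v := .inl L)
    (inl_mem_ends.2 (by simp [hl]))
  rcases inl_mem_ends.1 h1 with ⟨h3, -⟩ | ⟨-, i, h3⟩ | h3 | ⟨k', hk', h3⟩
  · omega
  · exact ⟨e', Or.inl ⟨i, h3⟩, h2⟩
  · have := hrange e' _ h3; omega
  · exact ⟨e', Or.inr ⟨k', hk'.symm, h3⟩, h2⟩

theorem exists_left_or_step_lt (hL : 0 < L)
    (h : exponentMap (fun e => sym2Exponent ((lab e).ends L)) s =
      exponentMap (fun e => sym2Exponent ((lab e).ends L)) t)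
    {i : ℕ} (hl : lab e = left i) (he : t e < s e) :
    ∃ e', ((∃ j, lab e' = left j) ∨ lab e' = step 0) ∧ s e' < t e' := by
  obtain ⟨e', h1, h2⟩ := exists_lt_of_mem_ends h he (v := .inl 0)
    (inl_mem_ends.2 (by simp [hl]))
  rcases inl_mem_ends.1 h1 with ⟨-, i, h3⟩ | ⟨h3, -⟩ | h3 | ⟨k', hk', h3⟩
  · exact ⟨e', Or.inl ⟨i, h3⟩, h2⟩
  · omega
  · exact ⟨e', Or.inr h3, h2⟩
  · omega

theorem exists_step_add_lt (hinj : Function.Injective lab)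
    (h : exponentMap (fun e => sym2Exponent ((lab e).ends L)) s =
      exponentMap (fun e => sym2Exponent ((lab e).ends L)) t)
    {k : ℕ} (j : ℕ) (hk : k + 2 * j < L) (hl : lab e = step k) (he : t e < s e) :
    ∃ e', lab e' = step (k + 2 * j) ∧ t e' < s e' := by
  induction j with
  | zero => exact ⟨e, hl, he⟩
  | succ j ih =>
    obtain ⟨e', h1, h2⟩ := ih (by omega)
    obtain ⟨e'', h3, h4⟩ := exists_step_succ_lt hinj h (by omega) h1 h2
    exact exists_step_succ_lt hinj h.symm (by omega) h3 h4

theorem exists_step_odd_lt (hinj : Function.Injective lab)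
    (h : exponentMap (fun e => sym2Exponent ((lab e).ends L)) s =
      exponentMap (fun e => sym2Exponent ((lab e).ends L)) t)
    {k : ℕ} (j : ℕ) (hk : 2 * (k + j) + 1 < L) (hl : lab e = step (2 * (k + j) + 1))
    (he : t e < s e) : ∃ e', lab e' = step (2 * k + 1) ∧ t e' < s e' := by
  induction j generalizing e with
  | zero => exact ⟨e, hl, he⟩
  | succ j ih =>
    obtain ⟨e', h1, h2⟩ := exists_step_pred_lt hinj h hk hl he
    obtain ⟨e'', h3, h4⟩ := exists_step_pred_lt (k := 2 * (k + j) + 1) hinj h.symm (by omega) h1 h2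
    exact ih (by omega) h3 h4

/-- A difference at an edge `left i` passes through `q_i` to `right i`; a difference on the path is
pushed to its end `p_L`, where some edge `right i` must compensate. -/
theorem exists_right_ne (hinj : Function.Injective lab)
    (hrange : ∀ e k, lab e = step k → k < L)
    (h : exponentMap (fun e => sym2Exponent ((lab e).ends L)) s =
      exponentMap (fun e => sym2Exponent ((lab e).ends L)) t) (hst : s ≠ t) :
    ∃ e i, lab e = right i ∧ s e ≠ t e := by
  have hstep : ∀ j : ℕ, ∀ (s t : σ →₀ ℕ) (e : σ) (k : ℕ),
      exponentMap (fun e => sym2Exponent ((lab e).ends L)) s =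
      exponentMap (fun e => sym2Exponent ((lab e).ends L)) t →
      k + 1 + j = L → lab e = step k → t e < s e → ∃ e i, lab e = right i ∧ s e ≠ t e := by
    intro j
    induction j with
    | zero =>
      intro s t e k h hk hl he
      obtain ⟨e', i, h1, h2⟩ := exists_right_lt_of_step hinj hrange h hk hl he
      exact ⟨e', i, h1, h2.ne⟩
    | succ j ih =>
      intro s t e k h hk hl he
      obtain ⟨e', h1, h2⟩ := exists_step_succ_lt hinj h (by omega) hl he
      obtain ⟨e', i, h1, h2⟩ := ih t s e' (k + 1) h.symm (by omega) h1 h2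
      exact ⟨e', i, h1, h2.symm⟩
  have main : ∀ (s t : σ →₀ ℕ) (e : σ),
      exponentMap (fun e => sym2Exponent ((lab e).ends L)) s =
      exponentMap (fun e => sym2Exponent ((lab e).ends L)) t →
      t e < s e → ∃ e i, lab e = right i ∧ s e ≠ t e := by
    intro s t e h he
    match hl : lab e with
    | left i =>
      obtain ⟨e', h1, h2⟩ := exists_right_lt hinj h hl he
      exact ⟨e', i, h1, h2.ne⟩
    | right i => exact ⟨e, i, hl, he.ne'⟩
    | step k =>
      have := hrange e k hl
      exact hstep (L - (k + 1)) s t e k h (by omega) hl he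
  obtain ⟨e, he⟩ := DFunLike.ne_iff.1 hst
  rcases he.lt_or_gt with h1 | h1
  · obtain ⟨e', i, h1, h2⟩ := main t s e h.symm h1
    exact ⟨e', i, h1, h2.symm⟩
  · exact main s t e h h1

theorem exists_left_of_right_ne (hinj : Function.Injective lab)
    (h : exponentMap (fun e => sym2Exponent ((lab e).ends L)) s =
      exponentMap (fun e => sym2Exponent ((lab e).ends L)) t) {i : ℕ} (hl : lab e = right i)
    (he : s e ≠ t e) : ∃ e', lab e' = left i := by
  rcases he.lt_or_gt with h1 | h1
  · obtain ⟨e', h2, -⟩ := exists_left_lt hinj h.symm hl h1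
    exact ⟨e', h2⟩
  · obtain ⟨e', h2, -⟩ := exists_left_lt hinj h hl h1
    exact ⟨e', h2⟩

/-- The exchange at `p_L` yields another `right` edge or the last step. As the length is even, the
last step has odd index, and the inequality travels back over all odd steps. -/
theorem exists_right_or_forall_step_lt {m : ℕ} (hm : 0 < m) (hinj : Function.Injective lab)
    (hrange : ∀ e k, lab e = step k → k < 2 * m)
    (h : exponentMap (fun e => sym2Exponent ((lab e).ends (2 * m))) s =
      exponentMap (fun e => sym2Exponent ((lab e).ends (2 * m))) t)
    {i : ℕ} (hl : lab e = right i) (he : s e < t e) :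
    (∃ e' j, lab e' = right j ∧ t e' < s e') ∨
      ∀ e' k, lab e' = step (2 * k + 1) → t e' < s e' := by
  obtain ⟨e', ⟨j, h1⟩ | ⟨k, hk, h1⟩, h2⟩ := exists_right_or_step_lt (by omega) hrange h.symm hl he
  · exact Or.inl ⟨e', j, h1, h2⟩
  · right
    intro e₁ k₁ h3
    have := hrange _ _ h3
    obtain ⟨e₂, h4, h5⟩ := exists_step_odd_lt (k := k₁) hinj h (m - 1 - k₁) (by omega)
      (h1.trans (congrArg step (by omega))) h2
    rwa [hinj (h3.trans h4.symm)]

theorem paired_right_or_steps {m : ℕ} (hm : 0 < m) (hinj : Function.Injective lab)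
    (hrange : ∀ e k, lab e = step k → k < 2 * m)
    (h : exponentMap (fun e => sym2Exponent ((lab e).ends (2 * m))) s =
      exponentMap (fun e => sym2Exponent ((lab e).ends (2 * m))) t) (hst : s ≠ t) :
    (∃ e j, lab e = right j ∧ (∃ e', lab e' = left j) ∧ s e ≠ 0) ∨
      ∀ e k, lab e = step (2 * k + 1) → s e ≠ 0 := by
  have key : ∀ e j, lab e = right j → t e < s e →
      ∃ e j, lab e = right j ∧ (∃ e', lab e' = left j) ∧ s e ≠ 0 := fun e j h1 h2 =>
    ⟨e, j, h1, exists_left_of_right_ne hinj h h1 h2.ne', by omega⟩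
  obtain ⟨e, i, h1, h2⟩ := exists_right_ne hinj hrange h hst
  rcases h2.lt_or_gt with h3 | h3
  · refine (exists_right_or_forall_step_lt hm hinj hrange h h1 h3).imp ?_ ?_
    · rintro ⟨e', j, h4, h5⟩
      exact key e' j h4 h5
    · intro H e k h4
      have := H e k h4
      omega
  · exact Or.inl (key e i h1 h3)

/-- An excess of `s` at `left 0` reaches `right 0` with one sign through `q_0` and with the opposite
sign along the path, whose length is odd. -/
theorem injective_exponentMap_of_odd {m : ℕ} (hinj : Function.Injective lab)
    (hrange : ∀ e k, lab e = step k → k < 2 * m + 1)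
    (hleft : ∀ e i, lab e = left i → i = 0) (hright : ∀ e i, lab e = right i → i = 0) :
    Function.Injective (exponentMap fun e => sym2Exponent ((lab e).ends (2 * m + 1))) := by
  have main : ∀ (s t : σ →₀ ℕ) (e : σ),
      exponentMap (fun e => sym2Exponent ((lab e).ends (2 * m + 1))) s =
      exponentMap (fun e => sym2Exponent ((lab e).ends (2 * m + 1))) t →
      lab e = left 0 → t e < s e → False := by
    intro s t e h hl he
    obtain ⟨e₁, ⟨j, h1⟩ | h1, h2⟩ := exists_left_or_step_lt (by omega) h hl he
    · obtain rfl := hleft _ _ h1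
      obtain rfl := hinj (h1.trans hl.symm)
      omega
    · obtain ⟨e₂, h3, h4⟩ := exists_step_add_lt hinj h.symm m (by omega) h1 h2
      obtain ⟨e₃, i, h5, h6⟩ := exists_right_lt_of_step hinj hrange h.symm (by omega) h3 h4
      obtain ⟨e₄, h7, h8⟩ := exists_right_lt hinj h hl he
      obtain rfl := hright _ _ h5
      obtain rfl := hinj (h5.trans h7.symm)
      omega
  intro s t h
  by_contra hst
  obtain ⟨e, i, h1, h2⟩ := exists_right_ne hinj hrange h hst
  obtain rfl := hright _ _ h1
  rcases h2.lt_or_gt with h3 | h3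
  · obtain ⟨e', h4, h5⟩ := exists_left_lt hinj h.symm h1 h3
    exact main s t e' h h4 h5
  · obtain ⟨e', h4, h5⟩ := exists_left_lt hinj h h1 h3
    exact main t s e' h.symm h4 h5

end PathFibres

/-! ### Decomposition for paths of even length. -/

section PathIdeals

open PathLabel

/-- The edges `left i`, `right i` and the path form an even cycle; both sides are perfect matchings
of it. -/
theorem sum_ends_even_eq (m i : ℕ) :
    sym2Exponent ((left i).ends (2 * m)) +
        ∑ k ∈ Finset.range m, sym2Exponent ((step (2 * k + 1)).ends (2 * m)) =
      sym2Exponent ((right i).ends (2 * m)) +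
        ∑ k ∈ Finset.range m, sym2Exponent ((step (2 * k)).ends (2 * m)) := by
  have h : ∀ n, Finsupp.single (.inl 0 : ℕ ⊕ ℕ) 1 +
      ∑ k ∈ Finset.range n, sym2Exponent ((step (2 * k + 1)).ends (2 * m)) =
      Finsupp.single (.inl (2 * n)) 1 +
        ∑ k ∈ Finset.range n, sym2Exponent ((step (2 * k)).ends (2 * m)) := by
    intro n
    induction n with
    | zero => simp
    | succ n ih =>
      rw [Finset.sum_range_succ, Finset.sum_range_succ, ← add_assoc, ih]
      simp only [PathLabel.ends, sym2Exponent_mk]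
      rw [show 2 * n + 1 + 1 = 2 * (n + 1) by ring]
      abel
  have h1 := h m
  simp only [PathLabel.ends, sym2Exponent_mk] at h1 ⊢
  rw [add_right_comm, h1]
  abel

theorem exponentMap_sum_single {σ τ ι : Type*} {w : σ → τ →₀ ℕ} (S : Finset ι) (g : ι → σ) :
    exponentMap w (∑ k ∈ S, Finsupp.single (g k) 1) = ∑ k ∈ S, w (g k) := by
  classical
  induction S using Finset.induction_on with
  | empty => simp [exponentMap]
  | insert a S ha ih =>
    rw [Finset.sum_insert ha, Finset.sum_insert ha, exponentMap_add, ih, exponentMap_single,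
      one_smul]

theorem ker_aeval_monomial_le {σ τ K : Type*} [Field K] {w : σ → τ →₀ ℕ}
    {J : Ideal (MvPolynomial σ K)} (hJ : ∀ s t : σ →₀ ℕ, exponentMap w s = exponentMap w t →
      s ≠ t → monomial s 1 ∈ J) :
    RingHom.ker (aeval (R := K) fun e => monomial (w e) (1 : K)) ≤ J := by
  intro f hf
  have := sum_smul_eq_zero_of_mem_ker hf (fun s => Ideal.Quotient.mkₐ K J (monomial s 1))
    fun s _ t _ hst => by
      by_cases h : s = t
      · rw [h]
      · have h1 := Ideal.Quotient.eq_zero_iff_mem.2 (hJ s t hst h)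
        have h2 := Ideal.Quotient.eq_zero_iff_mem.2 (hJ t s hst.symm (Ne.symm h))
        exact h1.trans h2.symm
  rw [← Ideal.Quotient.eq_zero_iff_mem, ← Ideal.Quotient.mkₐ_eq_mk K]
  refine Eq.trans ?_ this
  conv_lhs => rw [f.as_sum, map_sum]
  refine Finset.sum_congr rfl fun s _ => ?_
  rw [← map_smul, smul_monomial, smul_eq_mul, mul_one]

theorem mem_linearCoeffIdeal_of_exponentMap_eq {σ : Type u} {τ : Type*} {K : Type v} [Field K]
    {w : σ → τ →₀ ℕ} {y : σ} {u v : {x // x ≠ y} →₀ ℕ}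
    (h : w y + exponentMap (fun x : {x // x ≠ y} => w x) u =
      exponentMap (fun x : {x // x ≠ y} => w x) v) :
    monomial u 1 ∈
      linearCoeffIdeal y (RingHom.ker (aeval (R := K) fun e => monomial (w e) (1 : K))) := by
  refine ⟨-monomial v 1, ?_⟩
  rw [RingHom.mem_ker, map_add, map_mul, map_neg, map_neg, aeval_X, aeval_rename, aeval_rename]
  change _ * aeval (fun x : {x // x ≠ y} => monomial (w x) (1 : K)) _ +
    -aeval (fun x : {x // x ≠ y} => monomial (w x) (1 : K)) _ = _
  rw [aeval_monomial_one, aeval_monomial_one, monomial_mul, h, mul_one, add_neg_cancel]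

/-- The `left` edges belonging to a pair `left i`, `right i` are removed one at a time, while the
path stays intact. Without any pair the monomial map is injective. -/
theorem isGVD_of_pathLabel {K : Type v} [Field K] {m : ℕ} (hm : 0 < m) (n : ℕ) {σ : Type u}
    [Finite σ] (hn : Nat.card σ = n) (lab : σ → PathLabel) (hinj : Function.Injective lab)
    (hrange : ∀ e k, lab e = step k → k < 2 * m) (hex : ∀ k < 2 * m, ∃ e, lab e = step k) :
    IsGVD (RingHom.ker (aeval (R := K) fun e =>
      monomial (sym2Exponent ((lab e).ends (2 * m))) (1 : K))) := by
  classical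
  induction n using Nat.strong_induction_on generalizing σ with
  | _ n ih =>
  subst hn
  by_cases hpair : ∃ y b i, lab y = left i ∧ lab b = right i
  swap
  · refine isGVD_ker_of_injective fun s t hst => ?_
    by_contra hne
    obtain ⟨e, i, h1, h2⟩ := exists_right_ne hinj hrange hst hne
    obtain ⟨e', h3⟩ := exists_left_of_right_ne hinj hst h1 h2
    exact hpair ⟨e', e, i, h3, h1⟩
  obtain ⟨y, b, i, hy, hb⟩ := hpair
  have hby : b ≠ y := fun h => by rw [h, hy] at hb; cases hb
  have hinj' : Function.Injective fun x : {x // x ≠ y} => lab x := fun a b hab =>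
    Subtype.ext (hinj hab)
  have hex' : ∀ k < 2 * m, ∃ e : {x // x ≠ y}, lab e = step k := by
    intro k hk
    obtain ⟨e, he⟩ := hex k hk
    exact ⟨⟨e, fun h => by rw [h, hy] at he; cases he⟩, he⟩
  have hcard : Nat.card {x // x ≠ y} < Nat.card σ := Finite.card_subtype_lt (x := y) (by simp)
  -- With `y = left i`, the coefficients of `y` come from the 4-cycles through `q_i` and `q_j`,
  -- which give the variables in `Z`, and from the long even cycle, which gives the product over
  -- `T`.
  let Z : Set {x // x ≠ y} := {x | ∃ j, lab x = right j ∧ ∃ e : {x // x ≠ y}, lab e = left j}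
  let T : Set {x // x ≠ y} := {x | ∃ k, lab x = step (2 * k + 1)}
  refine IsGVD.of_toric (w := fun e => sym2Exponent ((lab e).ends (2 * m))) y
    (squarefreeIdeal K Z T) ?_ ?_ ?_ ?_ ?_
  · have : Nonempty {x // x ≠ y} := ⟨⟨b, hby⟩⟩
    choose! g hg using hex'
    refine squarefreeIdeal_le ?_ (∑ k ∈ Finset.range m, Finsupp.single (g (2 * k + 1)) 1) ?_ ?_
    · rintro z ⟨j, hz, e, he⟩
      refine mem_linearCoeffIdeal_of_exponentMap_eq
        (v := Finsupp.single e 1 + Finsupp.single ⟨b, hby⟩ 1) ?_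
      rw [exponentMap_add, exponentMap_single, exponentMap_single, exponentMap_single, hz, he, hy,
        hb]
      simp only [PathLabel.ends, sym2Exponent_mk, one_smul]
      abel
    · intro s hs e
      rw [Finsupp.finsetSum_apply]
      by_cases he : ∃ k < m, g (2 * k + 1) = e
      · obtain ⟨k, hk, rfl⟩ := he
        rw [Finset.sum_eq_single k]
        · have := hs (g (2 * k + 1)) ⟨k, hg _ (by omega)⟩
          simp; omega
        · intro k' hk' hne
          have hk'' := Finset.mem_range.1 hk'
          refine Finsupp.single_eq_of_ne fun h => hne ?_
          have h1 := hg (2 * k + 1) (by omega)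
          rw [h, hg (2 * k' + 1) (by omega), step.injEq] at h1
          omega
        · intro h; exact absurd (Finset.mem_range.2 hk) h
      · rw [Finset.sum_eq_zero]
        · exact Nat.zero_le _
        · intro k hk
          exact Finsupp.single_eq_of_ne fun h => he ⟨k, Finset.mem_range.1 hk, h.symm⟩
    · refine mem_linearCoeffIdeal_of_exponentMap_eq
        (v := Finsupp.single ⟨b, hby⟩ 1 + ∑ k ∈ Finset.range m, Finsupp.single (g (2 * k)) 1) ?_
      rw [exponentMap_add, exponentMap_single, exponentMap_sum_single, exponentMap_sum_single, hy,
        hb, one_smul]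
      refine Eq.trans ?_ ((sum_ends_even_eq m i).trans ?_)
      · refine congrArg _ (Finset.sum_congr rfl fun k hk => ?_)
        rw [hg (2 * k + 1) (by have := Finset.mem_range.1 hk; omega)]
      · refine congrArg _ (Finset.sum_congr rfl fun k hk => ?_)
        rw [hg (2 * k) (by have := Finset.mem_range.1 hk; omega)]
  · refine ker_aeval_monomial_le (w := fun x : {x // x ≠ y} => sym2Exponent ((lab x).ends (2 * m)))
      fun s t hst hne => monomial_mem_squarefreeIdeal _ ?_
    refine (paired_right_or_steps (lab := fun x : {x // x ≠ y} => lab x) hm hinj'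
      (fun e => hrange e) hst hne).imp ?_ ?_
    · rintro ⟨e, j, h1, h2, h3⟩
      exact ⟨e, ⟨j, h1, h2⟩, h3⟩
    · rintro h e ⟨k, hk⟩
      exact h e k hk
  · intro s t hst hlt
    refine monomial_mem_squarefreeIdeal _ ?_
    obtain ⟨b', hb', hlt'⟩ := exists_right_lt hinj hst hy hlt
    refine (exists_right_or_forall_step_lt hm hinj hrange hst hb' hlt').imp ?_ ?_
    · rintro ⟨e, j, h1, h2⟩
      have hey : e ≠ y := fun h => by rw [h, hy] at h1; cases h1
      obtain ⟨e', h3⟩ := exists_left_of_right_ne hinj hst h1 h2.ne'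
      -- If `e'` were `y`, then `e` would be the partner `b'` of `y`, where the inequality goes the
      -- other way.
      have hey' : e' ≠ y := by
        rintro rfl
        rw [hy, left.injEq] at h3
        subst h3
        rw [hinj (h1.trans hb'.symm)] at h2
        omega
      refine ⟨⟨e, hey⟩, ⟨j, h1, ⟨e', hey'⟩, h3⟩, ?_⟩
      simp only [Finsupp.comapDomain_apply]
      omega
    · rintro h e ⟨k, hk⟩
      have := h e k hk
      simp only [Finsupp.comapDomain_apply]
      omega
  · refine isGVD_squarefreeIdeal _ rfl (Set.disjoint_left.2 ?_)
    rintro x ⟨j, h1, -⟩ ⟨k, h2⟩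
    rw [h1] at h2
    cases h2
  · exact ih _ hcard rfl _ hinj' (fun e => hrange e) hex'

end PathIdeals


/-! ### From graphs to labelled monomial maps. -/

section EdgeLabels

/-- Renaming the vertices injectively does not change the kernel, so all graphs can be studied with
vertices in one fixed type. -/
theorem toricIdeal_eq_ker {K : Type v} [Field K] {V : Type u} (G : SimpleGraph V) {W : Type*}
    {ν : V → W} (hν : Function.Injective ν) :
    toricIdeal K G = RingHom.ker (aeval (R := K) fun e : G.edgeSet =>
      monomial (sym2Exponent (Sym2.map ν e)) (1 : K)) := by
  have h : (rename ν).comp (edgeMap K G) = aeval (R := K) fun e : G.edgeSet =>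
      monomial (sym2Exponent (Sym2.map ν e)) (1 : K) := by
    ext e : 1
    obtain ⟨e, he⟩ := e
    rw [AlgHom.comp_apply, edgeMap, aeval_X, aeval_X]
    induction e using Sym2.ind with
    | _ a b =>
      rw [Sym2.map_mk, sym2Exponent_mk]
      change rename ν (X a * X b) = _
      rw [map_mul, rename_X, rename_X, X, X, monomial_mul, one_mul]
  rw [← h]
  ext f
  rw [toricIdeal, RingHom.mem_ker, RingHom.mem_ker, AlgHom.comp_apply,
    map_eq_zero_iff _ (rename_injective ν hν)]

/-- The toric ideal of a graph in terms of an injective labelling of the edges. -/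
theorem exists_edgeLabel {K : Type v} [Field K] {V : Type u} {G : SimpleGraph V}
    {U W Λ : Type*} {H : SimpleGraph U} (φ : G ≃g H) {ν : U → W} (hν : Function.Injective ν)
    (ends : Λ → Sym2 W) (hends : ∀ a b, H.Adj a b → ∃ l, ends l = s(ν a, ν b)) :
    ∃ lab : G.edgeSet → Λ, Function.Injective lab ∧
      toricIdeal K G = RingHom.ker (aeval (R := K) fun e : G.edgeSet =>
        monomial (sym2Exponent (ends (lab e))) (1 : K)) ∧
      (∀ e, ∃ a b, H.Adj a b ∧ ends (lab e) = s(ν a, ν b)) ∧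
      ∀ a b, H.Adj a b → ∃ e, ends (lab e) = s(ν a, ν b) := by
  have hinj : Function.Injective (ν ∘ φ) := hν.comp φ.injective
  have h : ∀ e : G.edgeSet, ∃ l, ends l = Sym2.map (ν ∘ φ) e := by
    rintro ⟨e, he⟩
    induction e using Sym2.ind with
    | _ a b => exact hends _ _ (φ.map_adj_iff.2 he)
  choose lab hlab using h
  refine ⟨lab, fun e e' hee => ?_, ?_, ?_, ?_⟩
  · have := (hlab e).symm.trans ((congrArg ends hee).trans (hlab e'))
    exact Subtype.ext (Sym2.map.injective hinj this)
  · simp_rw [hlab]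
    exact toricIdeal_eq_ker G hinj
  · rintro ⟨e, he⟩
    rw [hlab]
    induction e using Sym2.ind with
    | _ a b => exact ⟨φ a, φ b, φ.map_adj_iff.2 he, rfl⟩
  · intro a b hab
    refine ⟨⟨s(φ.symm a, φ.symm b), φ.symm.map_adj_iff.2 hab⟩, ?_⟩
    rw [hlab]
    simp

/-- Bipartite graphs whose edges form a row nested set have geometrically vertex decomposable
toric ideals. -/
theorem isGVD_toricIdeal_of_isRowNested {K : Type v} [Field K] {V : Type u} [Finite V]
    {G : SimpleGraph V} {U : Type*} {H : SimpleGraph U} (φ : G ≃g H) {ν : U → ℕ ⊕ ℕ}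
    (hν : Function.Injective ν) (S : Set (ℕ × ℕ))
    (hS : IsRowNested S)
    (hH : ∀ a b, H.Adj a b → ∃ p ∈ S, s(Sum.inl p.1, Sum.inr p.2) = s(ν a, ν b))
    (hex : ∀ p ∈ S, ∃ a b, H.Adj a b ∧ s(Sum.inl p.1, Sum.inr p.2) = s(ν a, ν b)) :
    IsGVD (toricIdeal K G) := by
  have hends : Function.Injective
      fun p : ℕ × ℕ => (s(.inl p.1, .inr p.2) : Sym2 (ℕ ⊕ ℕ)) := by
    rintro ⟨a, b⟩ ⟨c, d⟩ h
    simpa using h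
  obtain ⟨lab, hinj, hker, hlab, hlab'⟩ := exists_edgeLabel (K := K) φ hν
    (fun p : ℕ × ℕ => (s(.inl p.1, .inr p.2) : Sym2 (ℕ ⊕ ℕ)))
    fun a b hab => (hH a b hab).imp fun _ h => h.2
  have hrange : Set.range lab = S := by
    ext p
    constructor
    · rintro ⟨e, rfl⟩
      obtain ⟨a, b, hab, he⟩ := hlab e
      obtain ⟨p, hp, hp'⟩ := hH a b hab
      rwa [hends (he.trans hp'.symm)]
    · intro hp
      obtain ⟨a, b, hab, he⟩ := hex p hp
      obtain ⟨e, he'⟩ := hlab' a b hab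
      exact ⟨e, hends (he'.trans he.symm)⟩
  classical
  have := isGVD_of_isRowNested (K := K) _ rfl lab ∅ hinj.injOn
    (by rwa [Set.compl_empty, Set.image_univ, hrange])
  simp only [Set.mem_empty_iff_false, if_false] at this
  rw [hker]
  exact this

end EdgeLabels

/-! ### The four families of graphs. -/

section Graphs

variable {K : Type v} [Field K] {V : Type u} [Finite V] {G : SimpleGraph V}

theorem isGVD_toricIdeal_ferrersGraph {n : ℕ} {lam : Fin (n + 1) → ℕ} (hlam : Antitone lam)
    (φ : G ≃g ferrersGraph lam) : IsGVD (toricIdeal K G) := by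
  refine isGVD_toricIdeal_of_isRowNested φ (ν := Sum.map Fin.val Fin.val)
    (Fin.val_injective.sumMap Fin.val_injective)
    {p | ∃ i : Fin (n + 1), (i : ℕ) = p.1 ∧ p.2 < lam i} ?_ ?_ ?_
  · rintro _ j j' ⟨i, rfl, h1⟩ ⟨i₁, h2, h3⟩
    obtain rfl := Fin.ext h2
    -- Rows get shorter downwards, so a cell has every cell above it in its column.
    refine Or.inl fun i' hi' _ => ⟨⟨i', hi'.trans i₁.2⟩, rfl, h3.trans_le (hlam ?_)⟩
    exact Fin.le_def.2 hi'.le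
  · intro a b hab
    rw [ferrersGraph, SimpleGraph.fromRel_adj] at hab
    rcases a with a | a <;> rcases b with b | b <;> simp at hab
    · exact ⟨(a, b), ⟨a, rfl, hab⟩, rfl⟩
    · exact ⟨(b, a), ⟨b, rfl, hab⟩, Sym2.eq_swap⟩
  · rintro ⟨_, j⟩ ⟨i, rfl, hj⟩
    refine ⟨.inl i, .inr ⟨j, hj.trans_le (hlam (Fin.zero_le i))⟩, ?_, rfl⟩
    rw [ferrersGraph, SimpleGraph.fromRel_adj]
    simpa using hj

theorem isGVD_toricIdeal_completeBipartiteGraph {n m : ℕ}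
    (φ : G ≃g completeBipartiteGraph (Fin n) (Fin m)) : IsGVD (toricIdeal K G) := by
  refine isGVD_toricIdeal_of_isRowNested φ (ν := Sum.map Fin.val Fin.val)
    (Fin.val_injective.sumMap Fin.val_injective) {p | p.1 < n ∧ p.2 < m} ?_ ?_ ?_
  · rintro i j j' ⟨h1, h2⟩ ⟨h3, h4⟩
    exact Or.inl fun i' hi' _ => ⟨hi'.trans h1, h4⟩
  · intro a b hab
    rcases a with a | a <;> rcases b with b | b <;> simp at hab
    · exact ⟨(a, b), ⟨a.2, b.2⟩, rfl⟩
    · exact ⟨(b, a), ⟨b.2, a.2⟩, Sym2.eq_swap⟩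
  · rintro ⟨i, j⟩ ⟨hi, hj⟩
    exact ⟨.inl ⟨i, hi⟩, .inr ⟨j, hj⟩, by simp, rfl⟩

open PathLabel

theorem PathLabel.ends_injective {L : ℕ} (hL : 0 < L) : Function.Injective (PathLabel.ends L) := by
  rintro (a | a | a) (b | b | b) h <;> simp [PathLabel.ends] at h
  · rw [h]
  · omega
  · omega
  · rw [h]
  · congr 1; omega

theorem isGVD_toricIdeal_graphGrd {r d : ℕ} (hr : 3 ≤ r) (φ : G ≃g graphGrd r d) :
    IsGVD (toricIdeal K G) := by
  -- The path has `2 * r - 3` inner vertices, hence length `2 * (r - 1)`: `x_1` and `x_2` become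
  -- `p_0` and `p_L`, the `z` vertices the inner points, and the `y` vertices the `q_j`.
  let ν : GVertex r d → ℕ ⊕ ℕ
    | .x i => .inl (i * (2 * (r - 1)))
    | .y j => .inr j
    | .z k => .inl (k + 1)
  have hν : Function.Injective ν := by
    rintro (a | a | a) (b | b | b) h <;> simp only [ν, Sum.inl.injEq, Sum.inr.injEq,
      reduceCtorEq] at h
    · fin_cases a <;> fin_cases b <;> simp at h ⊢ <;> omega
    · fin_cases a <;> simp at h; omega
    · rw [Fin.ext h]
    · fin_cases b <;> simp at h; omega
    · rw [Fin.ext (by omega : (a : ℕ) = b)]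
  have hxy : ∀ i j, ∃ l : PathLabel, l.ends (2 * (r - 1)) = s(ν (.x i), ν (.y j)) ∧
      ∀ k, l = step k → k < 2 * (r - 1) := by
    intro i j
    fin_cases i
    · exact ⟨left j, by simp [PathLabel.ends, ν], by simp⟩
    · exact ⟨right j, by simp [PathLabel.ends, ν], by simp⟩
  have hxz : ∀ (i : Fin 2) (k : Fin (2 * r - 3)),
      (i = 0 ∧ (k : ℕ) = 0) ∨ (i = 1 ∧ (k : ℕ) + 1 = 2 * r - 3) →
      ∃ l : PathLabel, l.ends (2 * (r - 1)) = s(ν (.x i), ν (.z k)) ∧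
        ∀ k, l = step k → k < 2 * (r - 1) := by
    rintro i k (⟨rfl, h⟩ | ⟨rfl, h⟩)
    · refine ⟨step 0, by simp [PathLabel.ends, ν, h], ?_⟩
      rintro _ ⟨⟩; omega
    · refine ⟨step (2 * r - 3), ?_, ?_⟩
      · rw [Sym2.eq_swap]
        simp [PathLabel.ends, ν, h]; omega
      · rintro _ ⟨⟩; omega
  have hzz : ∀ k l : Fin (2 * r - 3), (k : ℕ) + 1 = l →
      ∃ l' : PathLabel, l'.ends (2 * (r - 1)) = s(ν (.z k), ν (.z l)) ∧
        ∀ k, l' = step k → k < 2 * (r - 1) := by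
    intro k l h
    refine ⟨step (k + 1), by simp [PathLabel.ends, ν, ← h], ?_⟩
    rintro _ ⟨⟩; omega
  have hadj : ∀ a b, (graphGrd r d).Adj a b → ∃ l : PathLabel,
      l.ends (2 * (r - 1)) = s(ν a, ν b) ∧ ∀ k, l = step k → k < 2 * (r - 1) := by
    intro a b hab
    rw [graphGrd, SimpleGraph.fromRel_adj] at hab
    obtain ⟨-, hab | hab⟩ := hab
    · rcases a with a | a | a <;> rcases b with b | b | b <;> simp only at hab
      · exact hxy a b
      · exact hxz a b hab
      · exact hzz a b hab
    · rw [Sym2.eq_swap]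
      rcases a with a | a | a <;> rcases b with b | b | b <;> simp only at hab
      · exact hxy b a
      · exact hxz b a hab
      · exact hzz b a hab
  obtain ⟨lab, hinj, hker, hlab, hlab'⟩ := exists_edgeLabel (K := K) φ hν
    (PathLabel.ends (2 * (r - 1))) fun a b hab => (hadj a b hab).imp fun _ h => h.1
  have hends : Function.Injective (PathLabel.ends (2 * (r - 1))) :=
    PathLabel.ends_injective (by omega)
  rw [hker]
  refine isGVD_of_pathLabel (by omega) _ rfl lab hinj (fun e k hk => ?_) fun k hk => ?_
  · obtain ⟨a, b, hab, he⟩ := hlab e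
    obtain ⟨l, hl, hl'⟩ := hadj a b hab
    obtain rfl := hends (he.trans hl.symm)
    exact hl' k hk
  · have : ∃ a b, (graphGrd r d).Adj a b ∧ (step k).ends (2 * (r - 1)) = s(ν a, ν b) := by
      simp only [graphGrd, SimpleGraph.fromRel_adj]
      rcases Nat.eq_zero_or_pos k with rfl | h0
      · exact ⟨.x 0, .z ⟨0, by omega⟩, by simp, by simp [PathLabel.ends, ν]⟩
      rcases (Nat.le_sub_one_of_lt hk).lt_or_eq with h1 | h1
      · refine ⟨.z ⟨k - 1, by omega⟩, .z ⟨k, by omega⟩, ⟨?_, Or.inl ?_⟩, ?_⟩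
        · simp; omega
        · simp; omega
        · simp [PathLabel.ends, ν]; omega
      · refine ⟨.z ⟨k - 1, by omega⟩, .x 1, ⟨by simp, Or.inr (Or.inr ?_)⟩, ?_⟩
        · simp; omega
        · simp [PathLabel.ends, ν]; omega
    obtain ⟨a, b, hab, h⟩ := this
    obtain ⟨e, he⟩ := hlab' a b hab
    exact ⟨e, hends (he.trans h.symm)⟩

theorem cycleGraph_adj_val {n : ℕ} (hn : 3 ≤ n) {a b : Fin n} :
    (SimpleGraph.cycleGraph n).Adj a b ↔ (a : ℕ) + 1 = b ∨ (b : ℕ) + 1 = a ∨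
      ((a : ℕ) = 0 ∧ (b : ℕ) + 1 = n) ∨ ((b : ℕ) = 0 ∧ (a : ℕ) + 1 = n) := by
  rw [SimpleGraph.cycleGraph_adj']
  have key : ∀ a b : Fin n, (a - b).val = if b ≤ a then (a : ℕ) - b else n - b + a := by
    intro a b
    split_ifs with h
    · exact Fin.sub_val_of_le h
    · rw [Fin.sub_def]
      rw [Fin.le_def] at h
      exact Nat.mod_eq_of_lt (by omega)
  rw [key, key]
  simp only [Fin.le_def]
  split_ifs <;> omega

theorem isGVD_toricIdeal_cycleGraph {n : ℕ} (hn : 3 ≤ n) (φ : G ≃g SimpleGraph.cycleGraph n) :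
    IsGVD (toricIdeal K G) := by
  -- The last vertex of the cycle becomes `q_0`, and the others form a path of length `n - 2`, which
  -- has the parity of `n`.
  let ν : Fin n → ℕ ⊕ ℕ := fun j => if (j : ℕ) + 1 = n then .inr 0 else .inl j
  have hν : Function.Injective ν := by
    intro a b h
    simp only [ν] at h
    split_ifs at h with h1 h2 h2
    · exact Fin.ext (by omega)
    · exact Fin.ext (Sum.inl_injective h)
  have hadj : ∀ a b, (SimpleGraph.cycleGraph n).Adj a b → ∃ l : PathLabel,
      l.ends (n - 2) = s(ν a, ν b) ∧ (l = left 0 ∨ l = right 0 ∨ ∃ k < n - 2, l = step k) := by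
    have hsucc : ∀ a b : Fin n, (a : ℕ) + 1 = b → ∃ l : PathLabel,
        l.ends (n - 2) = s(ν a, ν b) ∧ (l = left 0 ∨ l = right 0 ∨ ∃ k < n - 2, l = step k) := by
      intro a b h
      have ha : ν a = .inl a := if_neg (by omega)
      by_cases hb : (b : ℕ) + 1 = n
      · refine ⟨right 0, ?_, by simp⟩
        rw [ha, show ν b = .inr 0 from if_pos hb, show (a : ℕ) = n - 2 by omega]
        rfl
      · refine ⟨step a, ?_, Or.inr (Or.inr ⟨a, by omega, rfl⟩)⟩
        rw [ha, show ν b = .inl b from if_neg hb, ← h]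
        rfl
    have hlast : ∀ a b : Fin n, (a : ℕ) = 0 ∧ (b : ℕ) + 1 = n → ∃ l : PathLabel,
        l.ends (n - 2) = s(ν a, ν b) ∧ (l = left 0 ∨ l = right 0 ∨ ∃ k < n - 2, l = step k) := by
      rintro a b ⟨h1, h2⟩
      refine ⟨left 0, ?_, by simp⟩
      rw [show ν a = .inl a from if_neg (by omega), show ν b = .inr 0 from if_pos h2, h1]
      rfl
    intro a b hab
    rcases (cycleGraph_adj_val hn).1 hab with h | h | h | h
    · exact hsucc a b h
    · rw [Sym2.eq_swap]; exact hsucc b a h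
    · exact hlast a b h
    · rw [Sym2.eq_swap]; exact hlast b a h
  obtain ⟨lab, hinj, hker, hlab, hlab'⟩ := exists_edgeLabel (K := K) φ hν
    (PathLabel.ends (n - 2)) fun a b hab => (hadj a b hab).imp fun _ h => h.1
  have hends : Function.Injective (PathLabel.ends (n - 2)) :=
    PathLabel.ends_injective (by omega)
  have hlabel : ∀ e, lab e = left 0 ∨ lab e = right 0 ∨ ∃ k < n - 2, lab e = step k := by
    intro e
    obtain ⟨a, b, hab, he⟩ := hlab e
    obtain ⟨l, hl, hl'⟩ := hadj a b hab
    obtain rfl := hends (he.trans hl.symm)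
    exact hl'
  have hrange : ∀ e k, lab e = step k → k < n - 2 := by
    intro e k hk
    rcases hlabel e with h | h | ⟨k', h', h⟩ <;> rw [hk] at h <;> cases h
    exact h'
  rw [hker]
  obtain ⟨m, h | h⟩ := (n - 2).even_or_odd'
  · rw [h] at hrange hends hlab' ⊢
    refine isGVD_of_pathLabel (by omega) _ rfl lab hinj hrange fun k hk => ?_
    obtain ⟨e, he⟩ := hlab' ⟨k, by omega⟩ ⟨k + 1, by omega⟩
      ((cycleGraph_adj_val hn).2 (Or.inl rfl))
    refine ⟨e, hends (he.trans ?_)⟩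
    simp only [ν]
    rw [if_neg (by omega), if_neg (by omega)]
    rfl
  · rw [h] at hrange ⊢
    refine isGVD_ker_of_injective (injective_exponentMap_of_odd hinj hrange ?_ ?_)
    · intro e i he
      rcases hlabel e with h | h | ⟨k', h', h⟩ <;> rw [he] at h <;> cases h
      rfl
    · intro e i he
      rcases hlabel e with h | h | ⟨k', h', h⟩ <;> rw [he] at h <;> cases h
      rfl

end Graphs

theorem mainTheorem11 {K : Type v} [Field K] [IsAlgClosed K] [CharZero K]
    {V : Type u} [Finite V] (G : SimpleGraph V) :
    ((∃ n : ℕ, 3 ≤ n ∧ Nonempty (G ≃g SimpleGraph.cycleGraph n)) →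
        IsGVD (toricIdeal K G)) ∧
      (∀ (n : ℕ) (lam : Fin (n + 1) → ℕ), Antitone lam → (∀ i, 0 < lam i) →
        Nonempty (G ≃g ferrersGraph lam) → IsGVD (toricIdeal K G)) ∧
      (∀ n m : ℕ, 1 ≤ n → 1 ≤ m →
        Nonempty (G ≃g completeBipartiteGraph (Fin n) (Fin m)) → IsGVD (toricIdeal K G)) ∧
      (∀ r d : ℕ, 3 ≤ r → 2 ≤ d →
        Nonempty (G ≃g graphGrd r d) → IsGVD (toricIdeal K G)) :=
  ⟨fun ⟨_, hn, ⟨φ⟩⟩ => isGVD_toricIdeal_cycleGraph hn φ,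
    fun _ _ hlam _ ⟨φ⟩ => isGVD_toricIdeal_ferrersGraph hlam φ,
    fun _ _ _ _ ⟨φ⟩ => isGVD_toricIdeal_completeBipartiteGraph φ,
    fun _ _ hr _ ⟨φ⟩ => isGVD_toricIdeal_graphGrd hr φ⟩
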